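/- Let $d\ge 1$ be an integer and let $B(x,r)$ denote the closed ball of $\mathbb{R}^d$ with centre $x$ and radius $r$. **Definitions.** - A Borel measure $\mu$ on $\mathbb{R}^d$ has *$n$-growth* if there is a constant $c_\mu<\infty$ with $\mu(B(x,r))\le c_\mu r^n$ for all $x\in\mathbb{R}^d$ and $r>0$. - A set $E\subset\mathbb{R}^d$ is *$n$-AD regular* if there is $c\in(0,\infty)$ with $c^{-1}r^n\le \mathcal{H}^n(E\cap B(x,r))\le c\,r^n$ for all $x\in E$ and all $0<r<\infty$ with $r\le \operatorname{diam}(E)\in[0,\infty]$. - A function $k:\{(x,y)\in\mathbb{R}^d\times\mathbb{R}^d: x\ne y\}\to\mathbb{C}$ is an *$n$-dimensional Calderón–Zygmund kernel* if there are $c>0$ and $0<\eta\le 1$ such that for all $x\neq y$, $$|k(x,y)|\le \frac{c}{|x-y|^n},$$ and $$|k(x,y)-k(x',y)|+|k(y,x)-k(y,x')|\le \frac{c\,|x-x'|^\eta}{|x-y|^{n+\eta}}\quad\text{whenever } |x-x'|\le |x-y|/2.$$ - For $\varepsilon>0$ and a finite complex Borel measure $\nu$ on $\mathbb{R}^d$,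 put $T^k_\varepsilon\nu(x)=\int_{|x-y|>\varepsilon}k(x,y)\,d\nu(y)$ for $x\in\mathbb{R}^d$. For a positive measure $\sigma$ and a function $f$, put $T^k_{\sigma,\varepsilon}f(x)=\int_{|x-y|>\varepsilon}k(x,y)f(y)\,d\sigma(y)$. - For a closed set $S\subset\mathbb{R}^d$, $M(S)$ is the space of finite complex Borel measures $\nu$ on $\mathbb{R}^d$ with $|\nu|(\mathbb{R}^d\setminus S)=0$, with norm $\|\nu\|=|\nu|(S)$ (total variation). **Theorem.** Let $U\subset\mathbb{R}^d$ be a domain (non-empty, open and connected) whose boundary $\Gamma=\partial U$ is $(d-1)$-AD regular, and let $\sigma=\mathcal{H}^{d-1}\lfloor_\Gamma$. Let $\mu$ be a Borel measure on $\mathbb{R}^d$ with $(d-1)$-growth such that $\mu(\mathbb{R}^d\setminus\overline U)=0$. Let $k$ be a $(d-1)$-dimensional Calderón–Zygmund kernel such that $T^k_\sigma$ is bounded from $L^2(\sigma)$ to $L^2(\mu)$, that is, for some constant $C$, $$\|T^k_{\sigma,\varepsilon}f\|_{L^2(\mu)}\le C\,\|f\|_{L^2(\sigma)}\qquad\text{for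 all } f\in L^2(\sigma)\text{ and all }\varepsilon>0.$$ Then $T^k$ is bounded from $M(\mathbb{R}^d\setminus U)$ to $L^{1,\infty}(\mu)$: there is a constant $c$ such that for all $\nu\in M(\mathbb{R}^d\setminus U)$, all $\lambda>0$ and all $\varepsilon>0$, $$\mu\bigl(\{x\in\mathbb{R}^d:\ |T^k_\varepsilon\nu(x)|>\lambda\}\bigr)\le \frac{c}{\lambda}\,\|\nu\|.$$ -/

import Mathlib

open MeasureTheory Set
open scoped ENNReal NNReal

noncomputable section

namespace CZ

/-- Euclidean space `ℝ^d`. -/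
abbrev Rd (d : ℕ) : Type := EuclideanSpace ℝ (Fin d)

/-- `n`-growth: `μ(B(x,r)) ≤ c r^n` for all centres `x` and radii `r > 0`. In particular such a
Borel measure is finite on bounded sets, hence Radon. -/
def HasGrowth {d : ℕ} (n : ℕ) (μ : Measure (Rd d)) : Prop :=
  ∃ c : ℝ, 0 < c ∧ ∀ x : Rd d, ∀ r : ℝ, 0 < r →
    μ (Metric.closedBall x r) ≤ ENNReal.ofReal (c * r ^ n)

/-- The restriction `H^n⌊E` of the `n`-dimensional Hausdorff measure to the set `E`. -/
def hausdorffOn {d : ℕ} (n : ℕ) (E : Set (Rd d)) : Measure (Rd d) :=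
  (Measure.hausdorffMeasure (n : ℝ)).restrict E

/-- `n`-Ahlfors-David regularity of a set `E`: for all `x ∈ E` and all (finite) radii
`0 < r ≤ diam E`, where `diam E` may be infinite, `c⁻¹ r^n ≤ H^n(E ∩ B(x,r)) ≤ c r^n`. -/
def IsADRegularSet {d : ℕ} (n : ℕ) (E : Set (Rd d)) : Prop :=
  ∃ c : ℝ, 0 < c ∧ ∀ x ∈ E, ∀ r : ℝ, 0 < r → ENNReal.ofReal r ≤ Metric.ediam E →
    ENNReal.ofReal (c⁻¹ * r ^ n) ≤ hausdorffOn n E (Metric.closedBall x r) ∧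
      hausdorffOn n E (Metric.closedBall x r) ≤ ENNReal.ofReal (c * r ^ n)

/-- `n`-dimensional Calderón-Zygmund kernels. Only the values of `k` off the diagonal matter. -/
def IsCZKernel {d : ℕ} (n : ℕ) (k : Rd d → Rd d → ℂ) : Prop :=
  ∃ c η : ℝ, 0 < c ∧ 0 < η ∧ η ≤ 1 ∧ ∀ x y : Rd d, x ≠ y →
    ‖k x y‖ ≤ c / ‖x - y‖ ^ n ∧
    ∀ x' : Rd d, ‖x - x'‖ ≤ ‖x - y‖ / 2 →
      ‖k x y - k x' y‖ + ‖k y x - k y x'‖ ≤ c * ‖x - x'‖ ^ η / ‖x - y‖ ^ ((n : ℝ) + η)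

/-- The truncated operator on complex measures,
`T_ε^k ν(x) = ∫_{|x-y|>ε} k(x,y) dν(y)`; the pairing is multiplication of complex numbers. -/
def truncMeas {d : ℕ} (k : Rd d → Rd d → ℂ) (ε : ℝ) (ν : ComplexMeasure (Rd d)) (x : Rd d) : ℂ :=
  ∫ᵛ y in {y | ε < ‖x - y‖}, k x y ∂[ContinuousLinearMap.mul ℝ ℂ; ν]

/-- The truncated operator on functions with respect to a positive measure `σ`,
`T_{σ,ε}^k f(x) = T_ε^k(fσ)(x) = ∫_{|x-y|>ε} k(x,y) f(y) dσ(y)`. -/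
def truncFun {d : ℕ} (k : Rd d → Rd d → ℂ) (σ : Measure (Rd d)) (ε : ℝ) (f : Rd d → ℂ)
    (x : Rd d) : ℂ :=
  ∫ y in {y | ε < ‖x - y‖}, k x y * f y ∂σ

/-- `T_σ^k` is bounded from `L^2(σ)` to `L^2(μ)`: the truncated operators are bounded, uniformly
in `ε > 0`. -/
def BoundedL2 {d : ℕ} (k : Rd d → Rd d → ℂ) (σ μ : Measure (Rd d)) : Prop :=
  ∃ C : ℝ≥0, ∀ ε : ℝ, 0 < ε → ∀ f : Rd d → ℂ, MemLp f 2 σ →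
    eLpNorm (truncFun k σ ε f) 2 μ ≤ C * eLpNorm f 2 σ

/-- `T^k` is bounded from `M(S)` to `L^{1,∞}(μ)`. The space `M(S)` consists of the complex measures
whose total variation `|ν|` vanishes off `S`, and its norm is `‖ν‖ = |ν|(S)`. The constant depends
neither on `ν`, nor on `t` (the level), nor on `ε`. -/
def BoundedWeakL1 {d : ℕ} (k : Rd d → Rd d → ℂ) (S : Set (Rd d)) (μ : Measure (Rd d)) : Prop :=
  ∃ c : ℝ≥0, ∀ ν : ComplexMeasure (Rd d), ν.variation Sᶜ = 0 → ∀ t : ℝ, 0 < t →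
    ∀ ε : ℝ, 0 < ε →
      μ {x | t < ‖truncMeas k ε ν x‖} ≤ c / ENNReal.ofReal t * ν.variation S

end CZ

end

/-!
Splitting a complex measure into Jordan parts reduces the weak type inequality to positive measures
`m`. Everything else rests on one device: replace `m` by a smeared measure `m'` with a density
against `σ`, so that the `L²` hypothesis applies to `m'`, while `T m - T m'` is small because the
kernel is smooth.

* If `m` lives on `Γ = ∂U`, fix the level `t` and call a ball of radius `r` heavy if its `m`-mass
  exceeds `t r ^ n`. By Vitali and the growth of `μ`, the heavy balls are covered by a set of
  `μ`-measure `≲ ‖m‖ / t`. Smear each point over a ball around it whose radius is a fraction of the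
  depth to which the point lies in the heavy balls, or of `ε` where that depth is smaller. At
  larger scales the balls are not heavy, so `m'` has density `≲ t`; the `L²` bound gives
  `∫ |T m'|² ≲ t ‖m‖`, and Chebyshev concludes. When the scale `(‖m‖ / t) ^ (1 / n)` exceeds
  `diam Γ`, the size of the kernel alone suffices.
* A point mass at `y ∉ U` at distance `δ ≤ diam Γ` from `Γ` is swept onto the part of `σ` in
  `B(y, 2δ)`. The error is bounded in `L¹(μ)`: far from `y` by smoothness, near `y` because `μ`
  lives at distance at least `δ` from `y` and by the `L²` bound. This reduces to measures on `Γ`.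
* If `δ > diam Γ`, then `U` lies in a ball of radius `δ`, because the complement of a ball is
  connected, and the image of the point mass is itself bounded in `L¹(μ)`.

In dimension `d = 1` the measure `μ` is finite and the kernel bounded.
-/

namespace CZ

open Metric ProbabilityTheory Filter Topology

noncomputable section

variable {d n : ℕ} {k : Rd d → Rd d → ℂ} {μ : Measure (Rd d)}

/-! ### Calderón–Zygmund kernels and their truncations -/

/-- The kernel `k` truncated to `|x - y| > ε`. -/
def truncKernel (k : Rd d → Rd d → ℂ) (ε : ℝ) (x y : Rd d) : ℂ :=
  {y | ε < ‖x - y‖}.indicator (k x) y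

/-- The truncated operator on positive measures, `T_ε^k m(x) = ∫_{|x-y|>ε} k(x,y) dm(y)`. It agrees
with `truncMeas` on finite positive measures, but is an ordinary Bochner integral. -/
def truncPos (k : Rd d → Rd d → ℂ) (ε : ℝ) (m : Measure (Rd d)) (x : Rd d) : ℂ :=
  ∫ y, truncKernel k ε x y ∂m

lemma measurableSet_lt_norm_sub (ε : ℝ) (x : Rd d) : MeasurableSet {y : Rd d | ε < ‖x - y‖} :=
  (isOpen_lt continuous_const (by fun_prop)).measurableSet

lemma truncKernel_of_lt {ε : ℝ} {x y : Rd d} (h : ε < ‖x - y‖) : truncKernel k ε x y = k x y :=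
  indicator_of_mem (show y ∈ {y | ε < ‖x - y‖} from h) _

lemma truncKernel_of_le {ε : ℝ} {x y : Rd d} (h : ‖x - y‖ ≤ ε) : truncKernel k ε x y = 0 :=
  indicator_of_notMem (show y ∉ {y | ε < ‖x - y‖} from h.not_gt) _

lemma IsCZKernel.exists_norm_sub_le (hk : IsCZKernel n k) :
    ∃ c η : ℝ, 0 < η ∧ ∀ x y x' y' : Rd d, x ≠ y → ‖x - x'‖ < ‖x - y'‖ / 2 →
      ‖y - y'‖ ≤ ‖y - x‖ / 2 →
      ‖k x' y' - k x y‖ ≤ c * ‖x - x'‖ ^ η / ‖x - y'‖ ^ ((n : ℝ) + η)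
        + c * ‖y - y'‖ ^ η / ‖y - x‖ ^ ((n : ℝ) + η) := by
  obtain ⟨c, η, -, hη, -, H⟩ := hk
  refine ⟨c, η, hη, fun x y x' y' hxy hx' hy' => ?_⟩
  have hne : x ≠ y' := fun e => by
    simp only [e, sub_self, norm_zero, zero_div] at hx'
    exact hx'.not_ge (norm_nonneg _)
  have hfst : ‖k x' y' - k x y'‖ ≤ c * ‖x - x'‖ ^ η / ‖x - y'‖ ^ ((n : ℝ) + η) :=
    (norm_sub_rev _ _).trans_le <|
      (le_add_of_nonneg_right (norm_nonneg _)).trans ((H x y' hne).2 x' hx'.le)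
  have hsnd : ‖k x y' - k x y‖ ≤ c * ‖y - y'‖ ^ η / ‖y - x‖ ^ ((n : ℝ) + η) :=
    (norm_sub_rev _ _).trans_le <|
      (le_add_of_nonneg_left (norm_nonneg _)).trans ((H y x hxy.symm).2 y' hy')
  exact (norm_sub_le_norm_sub_add_norm_sub _ _ _).trans (add_le_add hfst hsnd)

lemma IsCZKernel.continuousOn (hk : IsCZKernel n k) :
    ContinuousOn (Function.uncurry k) {p : Rd d × Rd d | p.1 ≠ p.2} := by
  obtain ⟨c, η, hη, H⟩ := hk.exists_norm_sub_le
  rintro ⟨x, y⟩ (hxy : x ≠ y)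
  apply ContinuousAt.continuousWithinAt
  have hpos : 0 < ‖x - y‖ := norm_pos_iff.2 (sub_ne_zero.2 hxy)
  have hfst : ContinuousAt (fun p : Rd d × Rd d => ‖x - p.1‖) (x, y) := by fun_prop
  have hdist : ContinuousAt (fun p : Rd d × Rd d => ‖x - p.2‖) (x, y) := by fun_prop
  have hsnd : ContinuousAt (fun p : Rd d × Rd d => ‖y - p.2‖) (x, y) := by fun_prop
  have hbound : ContinuousAt (fun p : Rd d × Rd d =>
      c * ‖x - p.1‖ ^ η / ‖x - p.2‖ ^ ((n : ℝ) + η)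
        + c * ‖y - p.2‖ ^ η / ‖y - x‖ ^ ((n : ℝ) + η)) (x, y) :=
    .add (.div (continuousAt_const.mul (hfst.rpow_const (Or.inr hη.le)))
        (hdist.rpow_const (Or.inl hpos.ne')) (Real.rpow_pos_of_pos hpos _).ne')
      (.div_const (continuousAt_const.mul (hsnd.rpow_const (Or.inr hη.le))) _)
  rw [ContinuousAt, tendsto_iff_norm_sub_tendsto_zero]
  refine squeeze_zero' (Eventually.of_forall fun _ => norm_nonneg _) ?_
    (by simpa [ContinuousAt, Real.zero_rpow hη.ne'] using hbound)
  have hfst' : ∀ᶠ p : Rd d × Rd d in 𝓝 (x, y), ‖x - p.1‖ < ‖x - p.2‖ / 2 :=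
    hfst.eventually_lt (hdist.div_const 2) (by simpa using hpos)
  have hsnd' : ∀ᶠ p : Rd d × Rd d in 𝓝 (x, y), ‖y - p.2‖ < ‖y - x‖ / 2 :=
    hsnd.eventually_lt continuousAt_const (by simpa [norm_sub_rev y x] using hpos)
  filter_upwards [hfst', hsnd'] with p hp₁ hp₂
  exact H x y p.1 p.2 hxy hp₁ hp₂.le

lemma IsCZKernel.measurable_truncKernel (hk : IsCZKernel n k) {ε : ℝ} (hε : 0 < ε) :
    Measurable (Function.uncurry (truncKernel k ε)) := by
  have hopen : IsOpen {p : Rd d × Rd d | ε < ‖p.1 - p.2‖} :=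
    isOpen_lt continuous_const (by fun_prop)
  have huncurry : Function.uncurry (truncKernel k ε)
      = {p : Rd d × Rd d | ε < ‖p.1 - p.2‖}.indicator (Function.uncurry k) := rfl
  rw [huncurry, ← piecewise_eq_indicator]
  refine ContinuousOn.measurable_piecewise (hk.continuousOn.mono ?_) continuousOn_const
    hopen.measurableSet
  rintro p (hp : ε < ‖p.1 - p.2‖) h
  rw [h, sub_self, norm_zero] at hp
  exact hp.not_gt hε

lemma IsCZKernel.measurable_truncKernel_right (hk : IsCZKernel n k) {ε : ℝ} (hε : 0 < ε)
    (x : Rd d) : Measurable (truncKernel k ε x) :=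
  (hk.measurable_truncKernel hε).of_uncurry_left

lemma IsCZKernel.measurable_truncKernel_left (hk : IsCZKernel n k) {ε : ℝ} (hε : 0 < ε)
    (y : Rd d) : Measurable (fun x => truncKernel k ε x y) :=
  (hk.measurable_truncKernel hε).of_uncurry_right

lemma IsCZKernel.measurable_truncPos (hk : IsCZKernel n k) {ε : ℝ} (hε : 0 < ε)
    (m : Measure (Rd d)) [SFinite m] : Measurable (truncPos k ε m) :=
  ((hk.measurable_truncKernel hε).stronglyMeasurable.integral_prod_right).measurable

lemma IsCZKernel.exists_norm_truncKernel_le (hk : IsCZKernel n k) : ∃ c : ℝ, 0 < c ∧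
    ∀ ε : ℝ, ∀ x y : Rd d, ∀ s : ℝ, 0 < s → (ε < ‖x - y‖ → s ≤ ‖x - y‖) →
      ‖truncKernel k ε x y‖ ≤ c / s ^ n := by
  obtain ⟨c, η, hc, -, -, H⟩ := hk
  refine ⟨c, hc, fun ε x y s hs h => ?_⟩
  rcases le_or_gt ‖x - y‖ ε with hle | hlt
  · rw [truncKernel_of_le hle, norm_zero]
    positivity
  · have hne : x ≠ y := fun e => (hs.trans_le (h hlt)).ne' (by rw [e, sub_self, norm_zero])
    rw [truncKernel_of_lt hlt]
    refine ((H x y hne).1).trans ?_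
    gcongr
    exact h hlt

lemma IsCZKernel.integrable_truncKernel (hk : IsCZKernel n k) {ε : ℝ} (hε : 0 < ε) (x : Rd d)
    (m : Measure (Rd d)) [IsFiniteMeasure m] : Integrable (truncKernel k ε x) m := by
  obtain ⟨c, -, hc⟩ := hk.exists_norm_truncKernel_le
  exact Integrable.of_bound (hk.measurable_truncKernel_right hε x).aestronglyMeasurable (c / ε ^ n)
    (Eventually.of_forall fun y => hc ε x y ε hε le_of_lt)

lemma HasGrowth.isLocallyFiniteMeasure (hμ : HasGrowth n μ) : IsLocallyFiniteMeasure μ := by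
  obtain ⟨c, -, h⟩ := hμ
  exact ⟨fun x => ⟨closedBall x 1, closedBall_mem_nhds x one_pos,
    (h x 1 one_pos).trans_lt ENNReal.ofReal_lt_top⟩⟩

lemma lintegral_le_tsum_measure_closedBall {X : Type*} [PseudoMetricSpace X] [MeasurableSpace X]
    [OpensMeasurableSpace X] (μ : Measure X) (y : X) {R : ℝ} (hR : 0 < R) {φ : ℝ → ℝ≥0∞}
    (hφ : AntitoneOn φ (Ici R)) :
    ∫⁻ x in {x | R ≤ dist x y}, φ (dist x y) ∂μ
      ≤ ∑' j : ℕ, φ (2 ^ j * R) * μ (closedBall y (2 ^ (j + 1) * R)) := by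
  have hannulus : ∀ x ∈ {x | R ≤ dist x y}, φ (dist x y)
      ≤ ∑' j : ℕ, (closedBall y (2 ^ (j + 1) * R)).indicator (fun _ => φ (2 ^ j * R)) x := by
    intro x hx
    obtain ⟨j, hj, hj'⟩ := exists_nat_pow_near ((one_le_div hR).2 hx) one_lt_two
    rw [le_div_iff₀ hR] at hj
    rw [div_lt_iff₀ hR] at hj'
    refine le_trans ?_ (ENNReal.le_tsum j)
    rw [indicator_of_mem (mem_closedBall.2 hj'.le)]
    exact hφ (le_mul_of_one_le_left hR.le (one_le_pow₀ one_le_two)) hx hj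
  calc ∫⁻ x in {x | R ≤ dist x y}, φ (dist x y) ∂μ
      ≤ ∫⁻ x, ∑' j : ℕ, (closedBall y (2 ^ (j + 1) * R)).indicator (fun _ => φ (2 ^ j * R)) x ∂μ :=
        (setLIntegral_mono' (isClosed_le continuous_const (by fun_prop)).measurableSet
          hannulus).trans (setLIntegral_le_lintegral _ _)
    _ = ∑' j : ℕ, φ (2 ^ j * R) * μ (closedBall y (2 ^ (j + 1) * R)) := by
        rw [lintegral_tsum fun j =>
          (measurable_const.indicator isClosed_closedBall.measurableSet).aemeasurable]
        simp_rw [lintegral_indicator_const isClosed_closedBall.measurableSet]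

lemma HasGrowth.exists_lintegral_rpow_le (hμ : HasGrowth n μ) {η : ℝ} (hη : 0 < η) :
    ∃ A : ℝ≥0, ∀ y : Rd d, ∀ R : ℝ, 0 < R →
      ∫⁻ x in {x | R ≤ ‖x - y‖}, ENNReal.ofReal (R ^ η / ‖x - y‖ ^ ((n : ℝ) + η)) ∂μ ≤ A := by
  obtain ⟨c, hc, hμ⟩ := hμ
  set q : ℝ := (2 : ℝ) ^ (-η) with hq
  have hq₀ : 0 < q := by positivity
  have hq₁ : q < 1 := Real.rpow_lt_one_of_one_lt_of_neg one_lt_two (by linarith)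
  have hsum : Summable fun j : ℕ => c * 2 ^ n * q ^ j :=
    (summable_geometric_of_lt_one hq₀.le hq₁).mul_left _
  refine ⟨(∑' j : ℕ, c * 2 ^ n * q ^ j).toNNReal, fun y R hR => ?_⟩
  have hannulus (j : ℕ) : R ^ η / (2 ^ j * R) ^ ((n : ℝ) + η) * (c * (2 ^ (j + 1) * R) ^ n)
      = c * 2 ^ n * q ^ j := by
    have hpow : (2 ^ j * R : ℝ) ^ ((n : ℝ) + η) = (2 ^ j * R) ^ n * ((q ^ j)⁻¹ * R ^ η) := by
      rw [Real.rpow_add (by positivity), Real.rpow_natCast,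
        Real.mul_rpow (by positivity) hR.le, hq, Real.rpow_neg (by norm_num), inv_pow, inv_inv,
        Real.rpow_pow_comm (by norm_num)]
    have : 0 < R ^ η := by positivity
    rw [hpow, pow_succ, mul_pow, mul_pow, mul_pow]
    field_simp
  have hanti : AntitoneOn (fun s : ℝ => ENNReal.ofReal (R ^ η / s ^ ((n : ℝ) + η))) (Ici R) := by
    intro s (hs : R ≤ s) s' _ hss'
    have := hR.trans_le hs
    dsimp only
    gcongr
  simp_rw [← dist_eq_norm]
  refine (lintegral_le_tsum_measure_closedBall μ y hR hanti).trans ?_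
  rw [ENNReal.ofNNReal_toNNReal, ENNReal.ofReal_tsum_of_nonneg (fun j => by positivity) hsum]
  refine ENNReal.tsum_le_tsum fun j => ?_
  rw [← hannulus j, ENNReal.ofReal_mul (by positivity)]
  gcongr
  exact hμ y _ (by positivity)

lemma IsCZKernel.exists_enorm_truncKernel_sub_le (hk : IsCZKernel n k) :
    ∃ c η : ℝ, 0 < c ∧ 0 < η ∧ ∀ ε R : ℝ, 0 < ε → ∀ x y z : Rd d, ‖y - z‖ ≤ R →
      2 * R ≤ ‖x - y‖ →
      ‖truncKernel k ε x y - truncKernel k ε x z‖ₑ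
        ≤ ENNReal.ofReal c * ENNReal.ofReal (R ^ η / ‖x - y‖ ^ ((n : ℝ) + η))
          + (closedBall y (2 * ε)).indicator (fun _ => ENNReal.ofReal (c / ε ^ n)) x := by
  obtain ⟨c₀, hc₀, hsize⟩ := hk.exists_norm_truncKernel_le
  obtain ⟨c₁, η, -, hη, -, H⟩ := hk
  refine ⟨max c₀ c₁, η, by positivity, hη, fun ε R hε x y z hyz hx => ?_⟩
  have hxy : ‖x - y‖ ≤ ‖x - z‖ + ‖y - z‖ := by
    simpa [norm_sub_rev z y] using norm_sub_le_norm_sub_add_norm_sub x z y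
  have htrunc (w : Rd d) : ‖truncKernel k ε x w‖ₑ ≤ ENNReal.ofReal (max c₀ c₁ / ε ^ n) := by
    rw [← ofReal_norm]
    refine ENNReal.ofReal_le_ofReal ((hsize ε x w ε hε le_of_lt).trans ?_)
    gcongr
    exact le_max_left _ _
  rcases le_or_gt ‖x - y‖ ε with hy | hy
  · rw [truncKernel_of_le hy, zero_sub, enorm_neg,
      indicator_of_mem (mem_closedBall_iff_norm.2 (by linarith))]
    exact (htrunc z).trans le_add_self
  rcases le_or_gt ‖x - z‖ ε with hz | hz
  · rw [truncKernel_of_le hz, sub_zero,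
      indicator_of_mem (mem_closedBall_iff_norm.2 (by linarith))]
    exact (htrunc y).trans le_add_self
  · rw [truncKernel_of_lt hy, truncKernel_of_lt hz, ← ENNReal.ofReal_mul (by positivity),
      ← ofReal_norm]
    refine le_trans (ENNReal.ofReal_le_ofReal ?_) le_self_add
    have hne : y ≠ x := fun e => (hε.trans hy).ne' (by rw [e, sub_self, norm_zero])
    have hsmooth := (H y x hne).2 z (by rw [norm_sub_rev y x]; linarith)
    rw [norm_sub_rev y x] at hsmooth
    refine ((le_add_of_nonneg_left (norm_nonneg _)).trans hsmooth).trans ?_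
    rw [mul_div_assoc]
    gcongr
    exact le_max_right _ _

lemma IsCZKernel.exists_setLIntegral_truncKernel_sub_le (hk : IsCZKernel n k)
    (hμ : HasGrowth n μ) :
    ∃ A : ℝ≥0, ∀ ε R : ℝ, 0 < ε → 0 < R → ∀ y z : Rd d, ‖y - z‖ ≤ R →
      ∫⁻ x in {x | 2 * R ≤ ‖x - y‖}, ‖truncKernel k ε x y - truncKernel k ε x z‖ₑ ∂μ ≤ A := by
  obtain ⟨c, η, hc, hη, hker⟩ := hk.exists_enorm_truncKernel_sub_le
  obtain ⟨A, hA⟩ := hμ.exists_lintegral_rpow_le hη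
  obtain ⟨c', hc', hμ⟩ := hμ
  refine ⟨c.toNNReal * A + (c * (c' * 2 ^ n)).toNNReal, fun ε R hε hR y z hyz => ?_⟩
  calc ∫⁻ x in {x | 2 * R ≤ ‖x - y‖}, ‖truncKernel k ε x y - truncKernel k ε x z‖ₑ ∂μ
      ≤ ∫⁻ x in {x | 2 * R ≤ ‖x - y‖},
          (ENNReal.ofReal c * ENNReal.ofReal (R ^ η / ‖x - y‖ ^ ((n : ℝ) + η))
          + (closedBall y (2 * ε)).indicator (fun _ => ENNReal.ofReal (c / ε ^ n)) x) ∂μ :=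
        setLIntegral_mono' (isClosed_le continuous_const (by fun_prop)).measurableSet
          fun x hx => hker ε R hε x y z hyz hx
    _ ≤ ENNReal.ofReal c * ∫⁻ x in {x | R ≤ ‖x - y‖},
          ENNReal.ofReal (R ^ η / ‖x - y‖ ^ ((n : ℝ) + η)) ∂μ
          + ENNReal.ofReal (c / ε ^ n) * μ (closedBall y (2 * ε)) := by
        rw [lintegral_add_right _
          (measurable_const.indicator isClosed_closedBall.measurableSet),
          lintegral_const_mul' _ _ ENNReal.ofReal_ne_top,
          ← lintegral_indicator_const isClosed_closedBall.measurableSet]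
        gcongr _ * ?_ + ?_
        · exact lintegral_mono_set fun x (hx : 2 * R ≤ _) => show R ≤ _ by linarith
        · exact setLIntegral_le_lintegral _ _
    _ ≤ ENNReal.ofReal c * A + ENNReal.ofReal (c / ε ^ n) * ENNReal.ofReal (c' * (2 * ε) ^ n) := by
        gcongr
        · exact hA y R hR
        · exact hμ y _ (by positivity)
    _ = _ := by
        have hcancel : c / ε ^ n * (c' * (2 * ε) ^ n) = c * (c' * 2 ^ n) := by
          rw [mul_pow]
          field_simp
        rw [← ENNReal.ofReal_mul (by positivity), hcancel]
        rfl

/-! ### From complex measures to positive measures -/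

section ComplexMeasure

variable {X E F F' G : Type*} [MeasurableSpace X] [NormedAddCommGroup E] [NormedAddCommGroup F]
  [NormedSpace ℝ F] [NormedAddCommGroup F'] [NormedSpace ℝ F']
  [NormedAddCommGroup G] [NormedSpace ℝ G]

lemma variation_mapRange_le (m : VectorMeasure X F) (L : F →L[ℝ] F') :
    (m.mapRange L.toLinearMap.toAddMonoidHom L.continuous).variation ≤ ‖L‖ₑ • m.variation := by
  refine VectorMeasure.variation_le_of_forall_enorm_le fun s _ => ?_
  refine (L.le_opENorm (m s)).trans ?_
  rw [Measure.smul_apply, smul_eq_mul]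
  gcongr
  exact m.enorm_measure_le_variation s

lemma integrable_mapRange {m : VectorMeasure X F} {f : X → E} (hf : m.Integrable f)
    (L : F →L[ℝ] F') :
    (m.mapRange L.toLinearMap.toAddMonoidHom L.continuous).Integrable f :=
  hf.of_measure_le_smul enorm_ne_top (variation_mapRange_le m L)

variable [NormedSpace ℝ E]

lemma integral_mapRange {m : VectorMeasure X F} {f : X → E} (hf : m.Integrable f)
    (L : F →L[ℝ] F') (B : E →L[ℝ] F' →L[ℝ] G) :
    ∫ᵛ x, f x ∂[B; m.mapRange L.toLinearMap.toAddMonoidHom L.continuous]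
      = ∫ᵛ x, f x ∂[(B.flip ∘L L).flip; m] := by
  rw [VectorMeasure.integral_eq_setToFun, VectorMeasure.integral_eq_setToFun]
  exact (setToFun_congr_measure_of_integrable ‖L‖ₑ enorm_ne_top (variation_mapRange_le m L)
    _ _ f hf).symm

lemma posPart_le_variation (s : SignedMeasure X) :
    s.toJordanDecomposition.posPart ≤ s.variation := by
  rw [← SignedMeasure.totalVariation_eq_variation]
  exact Measure.le_add_right le_rfl

lemma negPart_le_variation (s : SignedMeasure X) :
    s.toJordanDecomposition.negPart ≤ s.variation := by
  rw [← SignedMeasure.totalVariation_eq_variation]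
  exact Measure.le_add_left le_rfl

lemma integral_signedMeasure_eq_sub {s : SignedMeasure X} {f : X → E} (hf : s.Integrable f) :
    ∫ᵛ x, f x ∂<•s = ∫ x, f x ∂s.toJordanDecomposition.posPart
      - ∫ x, f x ∂s.toJordanDecomposition.negPart := by
  conv_lhs => rw [← s.toSignedMeasure_toJordanDecomposition]
  rw [JordanDecomposition.toSignedMeasure, VectorMeasure.integral_sub_vectorMeasure,
    VectorMeasure.integral_toSignedMeasure, VectorMeasure.integral_toSignedMeasure]
  · simpa only [VectorMeasure.Integrable, Measure.variation_toSignedMeasure] using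
      hf.mono_measure (posPart_le_variation s)
  · simpa only [VectorMeasure.Integrable, Measure.variation_toSignedMeasure] using
      hf.mono_measure (negPart_le_variation s)

lemma mapRange_re_add_mapRange_im (ν : ComplexMeasure X) :
    (ComplexMeasure.re ν).mapRange (Complex.ofRealCLM.smulRight 1).toLinearMap.toAddMonoidHom
        (Complex.ofRealCLM.smulRight 1).continuous
      + (ComplexMeasure.im ν).mapRange
        (Complex.ofRealCLM.smulRight Complex.I).toLinearMap.toAddMonoidHom
        (Complex.ofRealCLM.smulRight Complex.I).continuous = ν := by
  ext s _
  rw [add_apply]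
  change ((ν s).re : ℂ) * 1 + (ν s).im * Complex.I = ν s
  rw [mul_one, Complex.re_add_im]

lemma integral_complexMeasure_eq_add {ν : ComplexMeasure X} {f : X → ℂ}
    (hre : (ComplexMeasure.re ν).Integrable f) (him : (ComplexMeasure.im ν).Integrable f) :
    ∫ᵛ x, f x ∂[ContinuousLinearMap.mul ℝ ℂ; ν]
      = ∫ᵛ x, f x ∂<•(ComplexMeasure.re ν) + Complex.I * ∫ᵛ x, f x ∂<•(ComplexMeasure.im ν) := by
  have hpair (v : ℂ) : ((ContinuousLinearMap.mul ℝ ℂ).flip ∘L Complex.ofRealCLM.smulRight v).flip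
      = ContinuousLinearMap.compL ℝ ℝ ℂ ℂ (ContinuousLinearMap.mul ℝ ℂ v) ∘L
        (ContinuousLinearMap.lsmul ℝ ℝ).flip := by
    ext z
    simp [mul_comm]
  conv_lhs => rw [← mapRange_re_add_mapRange_im ν]
  rw [VectorMeasure.integral_add_vectorMeasure (integrable_mapRange hre _)
    (integrable_mapRange him _), integral_mapRange hre, integral_mapRange him, hpair, hpair,
    ← VectorMeasure.continuousLinearMap_apply_integral hre,
    ← VectorMeasure.continuousLinearMap_apply_integral him]
  simp only [ContinuousLinearMap.mul_apply', one_mul]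

lemma isFiniteMeasure_variation (s : SignedMeasure X) :
    IsFiniteMeasure s.variation := by
  rw [← SignedMeasure.totalVariation_eq_variation]
  infer_instance

lemma variation_re_le (ν : ComplexMeasure X) :
    (ComplexMeasure.re ν).variation ≤ ν.variation := by
  refine (variation_mapRange_le ν Complex.reCLM).trans_eq ?_
  rw [Complex.reCLM_enorm, one_smul]

lemma variation_im_le (ν : ComplexMeasure X) :
    (ComplexMeasure.im ν).variation ≤ ν.variation := by
  refine (variation_mapRange_le ν Complex.imCLM).trans_eq ?_
  rw [Complex.imCLM_enorm, one_smul]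

end ComplexMeasure

/-- The weak type `(1,1)` inequality restricted to finite positive measures carried by `S`. -/
def BoundedWeakL1Pos (k : Rd d → Rd d → ℂ) (S : Set (Rd d)) (μ : Measure (Rd d)) : Prop :=
  ∃ c : ℝ≥0, ∀ m : Measure (Rd d), IsFiniteMeasure m → m Sᶜ = 0 → ∀ t : ℝ, 0 < t →
    ∀ ε : ℝ, 0 < ε → μ {x | t < ‖truncPos k ε m x‖} ≤ c / ENNReal.ofReal t * m univ

lemma div_ofReal_half (a : ℝ≥0∞) (t : ℝ) :
    a / ENNReal.ofReal (t / 2) = 2 * (a / ENNReal.ofReal t) := by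
  rw [ENNReal.ofReal_div_of_pos two_pos, ENNReal.ofReal_ofNat, div_eq_mul_inv,
    ENNReal.inv_div (by simp) (by simp), div_eq_mul_inv, div_eq_mul_inv]
  ring

lemma measure_lt_norm_add_le {X E : Type*} [MeasurableSpace X] [SeminormedAddCommGroup E]
    (μ : Measure X) (u v : X → E) (t : ℝ) :
    μ {x | t < ‖u x + v x‖} ≤ μ {x | t / 2 < ‖u x‖} + μ {x | t / 2 < ‖v x‖} := by
  refine (measure_mono fun x (hx : t < _) => ?_).trans (measure_union_le _ _)
  by_contra! hcon
  simp only [mem_union, mem_ofPred_eq, not_or, not_lt] at hcon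
  linarith [norm_add_le (u x) (v x)]

lemma BoundedWeakL1Pos.exists_signedMeasure {S : Set (Rd d)} (h : BoundedWeakL1Pos k S μ)
    (hk : IsCZKernel n k) :
    ∃ c : ℝ≥0, ∀ s : SignedMeasure (Rd d), s.variation Sᶜ = 0 → ∀ t : ℝ, 0 < t → ∀ ε : ℝ, 0 < ε →
      μ {x | t < ‖∫ᵛ y, truncKernel k ε x y ∂<•s‖} ≤ c / ENNReal.ofReal t * s.variation univ := by
  obtain ⟨c, hc⟩ := h
  refine ⟨4 * c, fun s hs t ht ε hε => ?_⟩
  have := isFiniteMeasure_variation s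
  have hsplit (x : Rd d) : ∫ᵛ y, truncKernel k ε x y ∂<•s
      = truncPos k ε s.toJordanDecomposition.posPart x
        + -truncPos k ε s.toJordanDecomposition.negPart x := by
    rw [← sub_eq_add_neg]
    exact integral_signedMeasure_eq_sub (hk.integrable_truncKernel hε x s.variation)
  have hpart {m : Measure (Rd d)} (hm : m ≤ s.variation) :
      μ {x | t / 2 < ‖truncPos k ε m x‖} ≤ 2 * (c / ENNReal.ofReal t) * s.variation univ := by
    rw [← div_ofReal_half]
    exact (hc m (isFiniteMeasure_of_le _ hm) (Measure.absolutelyContinuous_of_le hm hs) _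
      (half_pos ht) ε hε).trans (by gcongr)
  simp_rw [hsplit]
  calc _ ≤ _ := measure_lt_norm_add_le μ _ _ t
    _ ≤ 2 * (c / ENNReal.ofReal t) * s.variation univ
          + 2 * (c / ENNReal.ofReal t) * s.variation univ := by
        simp_rw [norm_neg]
        exact add_le_add (hpart (posPart_le_variation s)) (hpart (negPart_le_variation s))
    _ = _ := by
        push_cast
        rw [div_eq_mul_inv, div_eq_mul_inv]
        ring

lemma BoundedWeakL1Pos.boundedWeakL1 {S : Set (Rd d)} (h : BoundedWeakL1Pos k S μ)
    (hk : IsCZKernel n k) (hS : MeasurableSet S) : BoundedWeakL1 k S μ := by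
  obtain ⟨c, hc⟩ := h.exists_signedMeasure hk
  refine ⟨4 * c, fun ν hν t ht ε hε => ?_⟩
  have hfin (s : SignedMeasure (Rd d)) (x : Rd d) : s.Integrable (truncKernel k ε x) := by
    have := isFiniteMeasure_variation s
    exact hk.integrable_truncKernel hε x s.variation
  have hsplit (x : Rd d) : truncMeas k ε ν x
      = ∫ᵛ y, truncKernel k ε x y ∂<•(ComplexMeasure.re ν)
        + Complex.I * ∫ᵛ y, truncKernel k ε x y ∂<•(ComplexMeasure.im ν) := by
    rw [← integral_complexMeasure_eq_add (hfin _ x) (hfin _ x)]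
    exact (VectorMeasure.integral_indicator (measurableSet_lt_norm_sub ε x)).symm
  have huniv : ν.variation univ = ν.variation S := by
    rw [← measure_add_measure_compl hS, hν, add_zero]
  have hpart {s : SignedMeasure (Rd d)} (hs : s.variation ≤ ν.variation) :
      μ {x | t / 2 < ‖∫ᵛ y, truncKernel k ε x y ∂<•s‖}
        ≤ 2 * (c / ENNReal.ofReal t) * ν.variation S := by
    rw [← div_ofReal_half, ← huniv]
    exact (hc s (Measure.absolutelyContinuous_of_le hs hν) _ (half_pos ht) ε hε).trans (by gcongr)
  simp_rw [hsplit]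
  calc _ ≤ _ := measure_lt_norm_add_le μ _ _ t
    _ ≤ 2 * (c / ENNReal.ofReal t) * ν.variation S
          + 2 * (c / ENNReal.ofReal t) * ν.variation S := by
        simp_rw [norm_mul, Complex.norm_I, one_mul]
        exact add_le_add (hpart (variation_re_le ν)) (hpart (variation_im_le ν))
    _ = _ := by
        push_cast
        rw [div_eq_mul_inv, div_eq_mul_inv]
        ring

/-! ### Smearing a measure by a Markov kernel -/

section Smear

variable {X : Type*} [PseudoMetricSpace X] [MeasurableSpace X] {σ : Measure X} {r : X → ℝ}

/-- The density, with respect to `σ`, of the normalized restriction of `σ` to the closed ball with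
centre `y` and radius `r y`. -/
def smearDensity (σ : Measure X) (r : X → ℝ) (y z : X) : ℝ≥0∞ :=
  (closedBall y (r y)).indicator (fun _ => (σ (closedBall y (r y)))⁻¹) z

/-- The centres `y` for which `σ` can be normalized on the closed ball of radius `r y`. -/
def smearSet (σ : Measure X) (r : X → ℝ) : Set X :=
  {y | σ (closedBall y (r y)) ≠ 0 ∧ σ (closedBall y (r y)) ≠ ∞}

lemma smearDensity_le (y z : X) : smearDensity σ r y z ≤ (σ (closedBall y (r y)))⁻¹ :=
  indicator_le_self' (fun _ _ => zero_le) z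

variable [OpensMeasurableSpace X]

lemma withDensity_smearDensity_apply (y : X) {s : Set X} (hs : MeasurableSet s) :
    σ.withDensity (smearDensity σ r y) s
      = (σ (closedBall y (r y)))⁻¹ * σ (closedBall y (r y) ∩ s) := by
  simp only [withDensity_apply _ hs, smearDensity]
  rw [setLIntegral_indicator isClosed_closedBall.measurableSet, setLIntegral_const]

variable [SecondCountableTopology X] [SFinite σ]

lemma measurableSet_mem_closedBall (hr : Measurable r) :
    MeasurableSet {p : X × X | p.2 ∈ closedBall p.1 (r p.1)} :=
  measurableSet_le (measurable_snd.dist measurable_fst) (hr.comp measurable_fst)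

lemma measurable_measure_closedBall (σ : Measure X) [SFinite σ] (hr : Measurable r) :
    Measurable fun y => σ (closedBall y (r y)) :=
  measurable_measure_prodMk_left (ν := σ) (measurableSet_mem_closedBall hr)

lemma measurable_smearDensity (σ : Measure X) [SFinite σ] (hr : Measurable r) :
    Measurable (Function.uncurry (smearDensity σ r)) := by
  have huncurry : Function.uncurry (smearDensity σ r)
      = {p : X × X | p.2 ∈ closedBall p.1 (r p.1)}.indicator
        (fun p => (σ (closedBall p.1 (r p.1)))⁻¹) := by
    ext p
    simp only [Function.uncurry, smearDensity, indicator, mem_ofPred_eq]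
  rw [huncurry]
  exact ((measurable_measure_closedBall σ hr).comp measurable_fst).inv.indicator
    (measurableSet_mem_closedBall hr)

lemma measurableSet_smearSet (σ : Measure X) [SFinite σ] (hr : Measurable r) :
    MeasurableSet (smearSet σ r) :=
  (measurable_measure_closedBall σ hr (measurableSet_singleton 0)).compl.inter
    (measurable_measure_closedBall σ hr (measurableSet_singleton ∞)).compl

open Classical in
/-- The Markov kernel that spreads a point mass at `y` evenly, with respect to `σ`, over
`closedBall y (r y)`. A point mass off `smearSet σ r` stays where it is. -/
def smearKernel (σ : Measure X) [SFinite σ] (hr : Measurable r) : Kernel X X :=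
  Kernel.piecewise (measurableSet_smearSet σ hr)
    (Kernel.withDensity (Kernel.const _ σ) (smearDensity σ r)) Kernel.id

lemma smearKernel_of_mem (hr : Measurable r) {y : X} (hy : y ∈ smearSet σ r) :
    smearKernel σ hr y = σ.withDensity (smearDensity σ r y) := by
  classical
  rw [smearKernel, Kernel.piecewise_apply, if_pos hy,
    Kernel.withDensity_apply _ (measurable_smearDensity σ hr), Kernel.const_apply]

lemma smearKernel_of_notMem (hr : Measurable r) {y : X} (hy : y ∉ smearSet σ r) :
    smearKernel σ hr y = Measure.dirac y := by
  classical
  rw [smearKernel, Kernel.piecewise_apply, if_neg hy, Kernel.id_apply]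

instance isMarkovKernel_smearKernel (hr : Measurable r) : IsMarkovKernel (smearKernel σ hr) := by
  refine ⟨fun y => ?_⟩
  by_cases hy : y ∈ smearSet σ r
  · rw [smearKernel_of_mem hr hy]
    refine ⟨?_⟩
    rw [withDensity_smearDensity_apply y MeasurableSet.univ, inter_univ,
      ENNReal.inv_mul_cancel hy.1 hy.2]
  · rw [smearKernel_of_notMem hr hy]
    infer_instance

lemma ae_smearKernel_mem_closedBall (σ : Measure X) [SFinite σ] (hr : Measurable r) {y : X}
    (hy : 0 ≤ r y) : ∀ᵐ z ∂(smearKernel σ hr y), z ∈ closedBall y (r y) := by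
  by_cases h : y ∈ smearSet σ r
  · rw [smearKernel_of_mem hr h, ae_iff, ← compl_def,
      withDensity_smearDensity_apply y isClosed_closedBall.measurableSet.compl, inter_compl_self,
      measure_empty, mul_zero]
  · rw [smearKernel_of_notMem hr h]
    exact (ae_dirac_iff (p := fun z => z ∈ closedBall y (r y))
      isClosed_closedBall.measurableSet).2 (mem_closedBall_self hy)

lemma bind_smearKernel (hr : Measurable r) {m : Measure X} [SFinite m]
    (h : ∀ᵐ y ∂m, y ∈ smearSet σ r) :
    m.bind (smearKernel σ hr) = σ.withDensity fun z => ∫⁻ y, smearDensity σ r y z ∂m := by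
  ext s hs
  rw [Measure.bind_apply hs (Kernel.aemeasurable _), withDensity_apply _ hs,
    lintegral_lintegral_swap (f := fun z y => smearDensity σ r y z)
      ((measurable_smearDensity σ hr).comp measurable_swap).aemeasurable]
  refine lintegral_congr_ae ?_
  filter_upwards [h] with y hy
  rw [smearKernel_of_mem hr hy, withDensity_apply _ hs]

end Smear

lemma measure_bind_univ {X Y : Type*} [MeasurableSpace X] [MeasurableSpace Y] (m : Measure X)
    (κ : Kernel X Y) [IsMarkovKernel κ] : m.bind κ univ = m univ := by
  rw [Measure.bind_apply MeasurableSet.univ κ.aemeasurable]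
  simp only [measure_univ, lintegral_one]

section Bind

variable {κ : Kernel (Rd d) (Rd d)} [IsMarkovKernel κ] {m : Measure (Rd d)}

lemma IsCZKernel.truncPos_bind (hk : IsCZKernel n k) {ε : ℝ} (hε : 0 < ε) [IsFiniteMeasure m]
    (x : Rd d) : truncPos k ε (m.bind κ) x = ∫ y, truncPos k ε (κ y) x ∂m := by
  have hint := hk.integrable_truncKernel hε x (m.bind κ)
  rw [Measure.comp_eq_comp_const_apply] at hint
  rw [truncPos, Measure.comp_eq_comp_const_apply, Kernel.integral_comp hint, Kernel.const_apply]
  rfl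

lemma IsCZKernel.measurable_truncPos_kernel (hk : IsCZKernel n k) {ε : ℝ} (hε : 0 < ε)
    (κ : Kernel (Rd d) (Rd d)) [IsMarkovKernel κ] :
    Measurable fun p : Rd d × Rd d => truncPos k ε (κ p.2) p.1 := by
  have hmap : Measurable fun q : (Rd d × Rd d) × Rd d => (q.1.1, q.2) := by fun_prop
  exact (((hk.measurable_truncKernel hε).comp hmap).stronglyMeasurable.integral_kernel_prod_right'
    (κ := κ.comap Prod.snd measurable_snd)).measurable

lemma IsCZKernel.integrable_truncPos_kernel (hk : IsCZKernel n k) {ε : ℝ} (hε : 0 < ε)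
    [IsFiniteMeasure m] (x : Rd d) : Integrable (fun y => truncPos k ε (κ y) x) m := by
  obtain ⟨c, -, hsize⟩ := hk.exists_norm_truncKernel_le
  have hmeas : Measurable fun y => truncPos k ε (κ y) x :=
    (hk.measurable_truncPos_kernel hε κ).of_uncurry_left (f := fun x y => truncPos k ε (κ y) x)
  refine Integrable.of_bound hmeas.aestronglyMeasurable (c / ε ^ n) (.of_forall fun y => ?_)
  simpa only [truncPos, probReal_univ, mul_one] using norm_integral_le_of_norm_le_const (μ := κ y)
    (.of_forall fun z => hsize ε x z ε hε le_of_lt)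

lemma IsCZKernel.lintegral_truncPos_sub_bind_le (hk : IsCZKernel n k) {ε : ℝ} (hε : 0 < ε)
    [SFinite μ] [IsFiniteMeasure m] {A : ℝ≥0∞}
    (h : ∀ᵐ y ∂m, ∫⁻ x, ‖truncKernel k ε x y - truncPos k ε (κ y) x‖ₑ ∂μ ≤ A) :
    ∫⁻ x, ‖truncPos k ε m x - truncPos k ε (m.bind κ) x‖ₑ ∂μ ≤ A * m univ := by
  have hmeas := (hk.measurable_truncKernel hε).sub (hk.measurable_truncPos_kernel hε κ)
  calc ∫⁻ x, ‖truncPos k ε m x - truncPos k ε (m.bind κ) x‖ₑ ∂μ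
      = ∫⁻ x, ‖∫ y, (truncKernel k ε x y - truncPos k ε (κ y) x) ∂m‖ₑ ∂μ := by
        refine lintegral_congr fun x => ?_
        rw [hk.truncPos_bind hε, integral_sub (hk.integrable_truncKernel hε x m)
          (hk.integrable_truncPos_kernel hε x), truncPos]
    _ ≤ ∫⁻ x, ∫⁻ y, ‖truncKernel k ε x y - truncPos k ε (κ y) x‖ₑ ∂m ∂μ :=
        lintegral_mono fun x => enorm_integral_le_lintegral_enorm _
    _ = ∫⁻ y, ∫⁻ x, ‖truncKernel k ε x y - truncPos k ε (κ y) x‖ₑ ∂μ ∂m :=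
        lintegral_lintegral_swap hmeas.enorm.aemeasurable
    _ ≤ ∫⁻ _, A ∂m := lintegral_mono_ae h
    _ = A * m univ := lintegral_const _

lemma IsCZKernel.lintegral_truncKernel_sub_truncPos_le (hk : IsCZKernel n k) {ε : ℝ} (hε : 0 < ε)
    [SFinite μ] [IsProbabilityMeasure m] {y : Rd d} {A : ℝ≥0∞}
    (h : ∀ᵐ z ∂m, ∫⁻ x, ‖truncKernel k ε x y - truncKernel k ε x z‖ₑ ∂μ ≤ A) :
    ∫⁻ x, ‖truncKernel k ε x y - truncPos k ε m x‖ₑ ∂μ ≤ A := by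
  have hmeas : Measurable fun p : Rd d × Rd d => truncKernel k ε p.1 y - truncKernel k ε p.1 p.2 :=
    ((hk.measurable_truncKernel_left hε y).comp measurable_fst).sub (hk.measurable_truncKernel hε)
  calc ∫⁻ x, ‖truncKernel k ε x y - truncPos k ε m x‖ₑ ∂μ
      = ∫⁻ x, ‖∫ z, (truncKernel k ε x y - truncKernel k ε x z) ∂m‖ₑ ∂μ := by
        refine lintegral_congr fun x => ?_
        rw [integral_sub (integrable_const _) (hk.integrable_truncKernel hε x m), integral_const,
          probReal_univ, one_smul, truncPos]
    _ ≤ ∫⁻ x, ∫⁻ z, ‖truncKernel k ε x y - truncKernel k ε x z‖ₑ ∂m ∂μ :=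
        lintegral_mono fun x => enorm_integral_le_lintegral_enorm _
    _ = ∫⁻ z, ∫⁻ x, ‖truncKernel k ε x y - truncKernel k ε x z‖ₑ ∂μ ∂m :=
        lintegral_lintegral_swap hmeas.enorm.aemeasurable
    _ ≤ ∫⁻ _, A ∂m := lintegral_mono_ae h
    _ = A := by rw [lintegral_const, measure_univ, mul_one]

end Bind

/-! ### The weak type inequality on a lower regular set -/

section Chebyshev

variable {X F : Type*} [MeasurableSpace X] [SeminormedAddCommGroup F] {ν : Measure X}

lemma measure_lt_norm_le_lintegral_pow_div {g : X → F} (p : ℕ)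
    (hg : AEMeasurable (fun x => ‖g x‖ₑ) ν) {s : ℝ} (hs : 0 < s) :
    ν {x | s < ‖g x‖} ≤ (∫⁻ x, ‖g x‖ₑ ^ p ∂ν) / ENNReal.ofReal s ^ p := by
  refine le_trans (measure_mono fun x (hx : s < ‖g x‖) => ?_)
    (meas_ge_le_lintegral_div (hg.pow_const p) (pow_ne_zero _ (by simpa using hs))
      (ENNReal.pow_ne_top ENNReal.ofReal_ne_top))
  rw [mem_ofPred_eq, ← ofReal_norm]
  gcongr

lemma measure_half_lt_norm_le_of_lintegral_sq_le {g : X → F}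
    (hg : AEMeasurable (fun x => ‖g x‖ₑ) ν) {t : ℝ} (ht : 0 < t) {D : ℝ≥0∞}
    (h : ∫⁻ x, ‖g x‖ₑ ^ 2 ∂ν ≤ ENNReal.ofReal t * D) :
    ν {x | t / 2 < ‖g x‖} ≤ 4 * (D / ENNReal.ofReal t) := by
  have ht0 : ENNReal.ofReal t ≠ 0 := (ENNReal.ofReal_pos.2 ht).ne'
  calc ν {x | t / 2 < ‖g x‖} ≤ (∫⁻ x, ‖g x‖ₑ ^ 2 ∂ν) / ENNReal.ofReal (t / 2) ^ 2 :=
        measure_lt_norm_le_lintegral_pow_div 2 hg (half_pos ht)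
    _ ≤ ENNReal.ofReal t * D / ENNReal.ofReal (t / 2) ^ 2 := ENNReal.div_le_div_right h _
    _ = ENNReal.ofReal t * (ENNReal.ofReal t)⁻¹ * (4 * (D / ENNReal.ofReal t)) := by
        rw [ENNReal.ofReal_div_of_pos two_pos, ENNReal.ofReal_ofNat, div_eq_mul_inv _ (_ ^ 2),
          ENNReal.inv_pow, ENNReal.inv_div (by simp) (by simp), div_eq_mul_inv, div_eq_mul_inv]
        ring
    _ = 4 * (D / ENNReal.ofReal t) := by
        rw [ENNReal.mul_inv_cancel ht0 ENNReal.ofReal_ne_top, one_mul]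

lemma measure_lt_norm_le_add_of_setLIntegral_compl {u v : X → F} {s : Set X}
    (hs : MeasurableSet s) (huv : AEMeasurable (fun x => ‖u x - v x‖ₑ) ν) {t : ℝ} (ht : 0 < t) :
    ν {x | t < ‖u x‖} ≤ ν s + 2 * ((∫⁻ x in sᶜ, ‖u x - v x‖ₑ ∂ν) / ENNReal.ofReal t)
      + ν {x | t / 2 < ‖v x‖} := by
  have hsplit : ν.restrict sᶜ {x | t < ‖u x‖} ≤ ν.restrict sᶜ {x | t / 2 < ‖u x - v x‖}
      + ν.restrict sᶜ {x | t / 2 < ‖v x‖} := by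
    simpa only [sub_add_cancel] using
      measure_lt_norm_add_le (ν.restrict sᶜ) (fun x => u x - v x) v t
  have hcheb := measure_lt_norm_le_lintegral_pow_div 1 huv.restrict (s := t / 2) (half_pos ht)
    (ν := ν.restrict sᶜ) (g := fun x => u x - v x)
  simp only [pow_one, div_ofReal_half] at hcheb
  calc ν {x | t < ‖u x‖} ≤ ν s + ν.restrict sᶜ {x | t < ‖u x‖} := by
        rw [Measure.restrict_apply' hs.compl]
        refine (measure_mono fun x hx => ?_).trans (measure_union_le _ _)
        exact (em (x ∈ s)).imp_right fun hxs => ⟨hx, hxs⟩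
    _ ≤ ν s + (2 * ((∫⁻ x in sᶜ, ‖u x - v x‖ₑ ∂ν) / ENNReal.ofReal t)
          + ν {x | t / 2 < ‖v x‖}) := by
        gcongr
        exact hsplit.trans (add_le_add hcheb (Measure.restrict_apply_le _ _))
    _ = _ := (add_assoc _ _ _).symm

end Chebyshev

section SquareFunction

variable {σ : Measure (Rd d)}

lemma truncPos_withDensity {f : Rd d → ℝ≥0∞} (hf : Measurable f) (hlt : ∀ᵐ z ∂σ, f z < ∞)
    (ε : ℝ) (x : Rd d) :
    truncPos k ε (σ.withDensity f) x = truncFun k σ ε (fun z => ((f z).toReal : ℂ)) x := by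
  rw [truncPos, integral_withDensity_eq_integral_toReal_smul hf hlt, truncFun,
    ← integral_indicator (measurableSet_lt_norm_sub ε x)]
  congr 1
  ext y
  by_cases hy : ε < ‖x - y‖
  · rw [truncKernel_of_lt hy, indicator_of_mem (by exact hy), Complex.real_smul, mul_comm]
  · rw [truncKernel_of_le (not_lt.1 hy), indicator_of_notMem (by exact hy), smul_zero]

lemma eLpNorm_two_sq {X F : Type*} [MeasurableSpace X] [NormedAddCommGroup F] (f : X → F)
    (ν : Measure X) : eLpNorm f 2 ν ^ 2 = ∫⁻ x, ‖f x‖ₑ ^ 2 ∂ν := by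
  simpa using eLpNorm_nnreal_pow_eq_lintegral (f := f) (μ := ν) (p := 2) two_ne_zero

lemma BoundedL2.exists_lintegral_sq_le (hT : BoundedL2 k σ μ) : ∃ C : ℝ≥0, ∀ ε : ℝ, 0 < ε →
    ∀ f : Rd d → ℝ≥0∞, Measurable f → ∀ K : ℝ≥0∞, K ≠ ∞ → (∀ᵐ z ∂σ, f z ≤ K) →
      σ.withDensity f univ ≠ ∞ →
      ∫⁻ x, ‖truncPos k ε (σ.withDensity f) x‖ₑ ^ 2 ∂μ ≤ C * K * σ.withDensity f univ := by
  obtain ⟨C, hC⟩ := hT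
  refine ⟨C ^ 2, fun ε hε f hf K hK hfK hfin => ?_⟩
  have hlt : ∀ᵐ z ∂σ, f z < ∞ := hfK.mono fun z hz => hz.trans_lt hK.lt_top
  set g : Rd d → ℂ := fun z => ((f z).toReal : ℂ) with hg
  have hnorm : ∀ᵐ z ∂σ, ‖g z‖ₑ = f z := by
    filter_upwards [hlt] with z hz
    rw [hg, ← ofReal_norm, Complex.norm_real, Real.norm_of_nonneg ENNReal.toReal_nonneg,
      ENNReal.ofReal_toReal hz.ne]
  have hsq : eLpNorm g 2 σ ^ 2 ≤ K * σ.withDensity f univ := by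
    rw [eLpNorm_two_sq, withDensity_apply _ MeasurableSet.univ, Measure.restrict_univ,
      ← lintegral_const_mul _ hf]
    refine lintegral_mono_ae ?_
    filter_upwards [hnorm, hfK] with z hz hzK
    rw [hz, sq]
    gcongr
  have hmem : MemLp g 2 σ := by
    refine ⟨(Complex.measurable_ofReal.comp hf.ennreal_toReal).aestronglyMeasurable, ?_⟩
    exact ENNReal.pow_lt_top_iff.1 (hsq.trans_lt (ENNReal.mul_lt_top hK.lt_top hfin.lt_top))
      |>.resolve_right two_ne_zero
  simp_rw [truncPos_withDensity hf hlt]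
  calc ∫⁻ x, ‖truncFun k σ ε g x‖ₑ ^ 2 ∂μ = eLpNorm (truncFun k σ ε g) 2 μ ^ 2 :=
        (eLpNorm_two_sq _ _).symm
    _ ≤ (C * eLpNorm g 2 σ) ^ 2 := by
        gcongr
        exact hC ε hε g hmem
    _ = C ^ 2 * eLpNorm g 2 σ ^ 2 := mul_pow _ _ _
    _ ≤ C ^ 2 * (K * σ.withDensity f univ) := by gcongr
    _ = _ := by rw [mul_assoc, ENNReal.coe_pow]

lemma BoundedL2.exists_lintegral_smearKernel_sq_le [SFinite σ] (hT : BoundedL2 k σ μ) :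
    ∃ C : ℝ≥0, ∀ ε : ℝ, 0 < ε → ∀ (r : Rd d → ℝ) (hr : Measurable r), ∀ y ∈ smearSet σ r,
      ∫⁻ x, ‖truncPos k ε (smearKernel σ hr y) x‖ₑ ^ 2 ∂μ ≤ C * (σ (closedBall y (r y)))⁻¹ := by
  obtain ⟨C, hC⟩ := hT.exists_lintegral_sq_le
  refine ⟨C, fun ε hε r hr y hy => ?_⟩
  have huniv : σ.withDensity (smearDensity σ r y) univ = 1 := by
    rw [← smearKernel_of_mem hr hy, measure_univ]
  rw [smearKernel_of_mem hr hy]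
  simpa only [huniv, mul_one] using hC ε hε _ ((measurable_smearDensity σ hr).of_uncurry_left) _
    (ENNReal.inv_ne_top.2 hy.1) (.of_forall (smearDensity_le y))
    (huniv.trans_ne ENNReal.one_ne_top)

end SquareFunction

section Vitali

variable {X : Type*} [PseudoMetricSpace X] [TopologicalSpace.SeparableSpace X] [MeasurableSpace X]
  [OpensMeasurableSpace X]

lemma exists_measurableSet_closedBall_subset {μ m : Measure X} {B : Set (X × ℝ)} {R : ℝ}
    {K : ℝ≥0∞} (hpos : ∀ p ∈ B, 0 < p.2) (hR : ∀ p ∈ B, p.2 ≤ R)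
    (hμ : ∀ p ∈ B, μ (closedBall p.1 (5 * p.2)) ≤ K * m (closedBall p.1 p.2)) :
    ∃ s : Set X, MeasurableSet s ∧ (∀ p ∈ B, closedBall p.1 p.2 ⊆ s) ∧ μ s ≤ K * m univ := by
  obtain ⟨u, huB, hdisj, hcov⟩ :=
    Vitali.exists_disjoint_subfamily_covering_enlargement_closedBall B Prod.fst Prod.snd R hR 5
      (by norm_num)
  have hcount : u.Countable := hdisj.countable_of_nonempty_interior fun p hp =>
    ⟨p.1, ball_subset_interior_closedBall (mem_ball_self (hpos p (huB hp)))⟩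
  refine ⟨⋃ p ∈ u, closedBall p.1 (5 * p.2),
    MeasurableSet.biUnion hcount fun p _ => isClosed_closedBall.measurableSet, fun p hp => ?_, ?_⟩
  · obtain ⟨q, hq, hsub⟩ := hcov p hp
    exact hsub.trans (subset_biUnion_of_mem (u := fun p : X × ℝ => closedBall p.1 (5 * p.2)) hq)
  · calc μ (⋃ p ∈ u, closedBall p.1 (5 * p.2))
        ≤ ∑' p : u, μ (closedBall p.1.1 (5 * p.1.2)) := measure_biUnion_le μ hcount _
      _ ≤ ∑' p : u, K * m (closedBall p.1.1 p.1.2) :=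
          ENNReal.tsum_le_tsum fun p => hμ p (huB p.2)
      _ = K * m (⋃ p ∈ u, closedBall p.1 p.2) := by
          rw [ENNReal.tsum_mul_left,
            measure_biUnion hcount hdisj fun p _ => isClosed_closedBall.measurableSet]
      _ ≤ K * m univ := by
          gcongr
          exact subset_univ _

end Vitali

section HeavyBalls

variable {X : Type*} [PseudoMetricSpace X] [MeasurableSpace X] {m : Measure X} {t : ℝ}

/-- The balls, encoded as pairs (centre, radius), in which the density of `m` relative to the
`n`-th power of the radius exceeds `t`. -/
def heavyBalls (n : ℕ) (m : Measure X) (t : ℝ) : Set (X × ℝ) :=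
  {p | 0 < p.2 ∧ ENNReal.ofReal (t * p.2 ^ n) < m (closedBall p.1 p.2)}

lemma radius_le_of_mem_heavyBalls (hn : n ≠ 0) (ht : 0 < t) {R : ℝ} (hR : 0 ≤ R)
    (hm : m univ ≤ ENNReal.ofReal (t * R ^ n)) {p : X × ℝ} (hp : p ∈ heavyBalls n m t) :
    p.2 ≤ R := by
  have hlt := hp.2.trans_le ((measure_mono (subset_univ _)).trans hm)
  have hpow : t * p.2 ^ n < t * R ^ n := (ENNReal.ofReal_lt_ofReal_iff'.1 hlt).1
  exact le_of_pow_le_pow_left₀ hn hR (le_of_mul_le_mul_left hpow.le ht)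

lemma HasGrowth.exists_measurableSet_heavyBalls_subset (hμ : HasGrowth n μ) : ∃ c : ℝ≥0,
    ∀ (m : Measure (Rd d)) (t R : ℝ), 0 < t → (∀ p ∈ heavyBalls n m t, p.2 ≤ R) →
      ∃ s : Set (Rd d), MeasurableSet s ∧ (∀ p ∈ heavyBalls n m t, closedBall p.1 p.2 ⊆ s) ∧
        μ s ≤ c / ENNReal.ofReal t * m univ := by
  obtain ⟨c, hc, hμ⟩ := hμ
  refine ⟨(c * 5 ^ n).toNNReal, fun m t R ht hR =>
    exists_measurableSet_closedBall_subset (fun p hp => hp.1) hR fun p ⟨hp, hheavy⟩ => ?_⟩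
  calc μ (closedBall p.1 (5 * p.2)) ≤ ENNReal.ofReal (c * (5 * p.2) ^ n) :=
        hμ _ _ (by positivity)
    _ = ENNReal.ofReal (c * 5 ^ n / t) * ENNReal.ofReal (t * p.2 ^ n) := by
        rw [← ENNReal.ofReal_mul (by positivity), mul_pow]
        congr 1
        field_simp
    _ ≤ (c * 5 ^ n).toNNReal / ENNReal.ofReal t * m (closedBall p.1 p.2) := by
        rw [ENNReal.ofReal_div_of_pos ht]
        exact mul_le_mul' le_rfl hheavy.le

end HeavyBalls

section StopRadius

variable {X : Type*} [PseudoMetricSpace X] {B : Set (X × ℝ)} {τ R : ℝ}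

/-- The stopping radius of `y` for a family `B` of balls, encoded as pairs (centre, radius): the
largest depth of `y` inside a ball of `B`, and at least `τ`. It is meaningful when the radii in `B`
are bounded. -/
def stopRadius (B : Set (X × ℝ)) (τ : ℝ) (y : X) : ℝ :=
  sSup {s | s ≤ τ ∨ ∃ p ∈ B, s + dist y p.1 ≤ p.2}

lemma stopRadius_le (hτ : τ ≤ R) (hR : ∀ p ∈ B, p.2 ≤ R) (y : X) : stopRadius B τ y ≤ R := by
  refine csSup_le ⟨τ, Or.inl le_rfl⟩ ?_
  rintro s (hs | ⟨p, hp, hs⟩)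
  · exact hs.trans hτ
  · linarith [hR p hp, dist_nonneg (x := y) (y := p.1)]

lemma le_stopRadius (hR : ∀ p ∈ B, p.2 ≤ R) {y : X} {s : ℝ}
    (h : s ≤ τ ∨ ∃ p ∈ B, s + dist y p.1 ≤ p.2) : s ≤ stopRadius B τ y := by
  refine le_csSup ⟨max τ R, ?_⟩ h
  rintro s (hs | ⟨p, hp, hs⟩)
  · exact le_max_of_le_left hs
  · exact le_max_of_le_right (by linarith [hR p hp, dist_nonneg (x := y) (y := p.1)])

lemma stopRadius_le_add_dist (hR : ∀ p ∈ B, p.2 ≤ R) (y z : X) :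
    stopRadius B τ y ≤ stopRadius B τ z + dist y z := by
  refine csSup_le ⟨τ, Or.inl le_rfl⟩ ?_
  rintro s (hs | ⟨p, hp, hs⟩)
  · linarith [le_stopRadius hR (y := z) (Or.inl hs), dist_nonneg (x := y) (y := z)]
  · linarith [le_stopRadius (τ := τ) hR (y := z) (s := s - dist y z)
      (Or.inr ⟨p, hp, by linarith [dist_triangle_left z p.1 y]⟩)]

lemma notMem_of_stopRadius_lt (hR : ∀ p ∈ B, p.2 ≤ R) {y : X} {s : ℝ}
    (h : stopRadius B τ y < s) : (y, s) ∉ B := fun hys =>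
  h.not_ge (le_stopRadius hR (Or.inr ⟨(y, s), hys, by rw [dist_self, add_zero]⟩))

lemma lt_or_exists_of_lt_stopRadius {y : X} {s : ℝ} (h : s < stopRadius B τ y) :
    s < τ ∨ ∃ p ∈ B, s + dist y p.1 < p.2 := by
  obtain ⟨s', hs' | ⟨p, hp, hs'⟩, hlt⟩ := exists_lt_of_lt_csSup ⟨τ, Or.inl le_rfl⟩ h
  · exact Or.inl (hlt.trans_le hs')
  · exact Or.inr ⟨p, hp, by linarith⟩

end StopRadius

lemma lintegral_smearDensity_le {X : Type*} [PseudoMetricSpace X] [MeasurableSpace X]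
    [OpensMeasurableSpace X] {σ m : Measure X} {ρ : X → ℝ} (hρ0 : ∀ y, 0 < ρ y)
    (hρ : ∀ y z, ρ y ≤ ρ z + dist y z) {a t : ℝ} (ha : 0 < a)
    (hσ : ∀ᵐ y ∂m, ENNReal.ofReal (a * (ρ y / 10) ^ n) ≤ σ (closedBall y (ρ y / 10))) {z : X}
    (hm : m (closedBall z (2 * ρ z)) ≤ ENNReal.ofReal (t * (2 * ρ z) ^ n)) :
    ∫⁻ y, smearDensity σ (fun y => ρ y / 10) y z ∂m ≤ ENNReal.ofReal (22 ^ n / a * t) := by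
  have hz := hρ0 z
  calc ∫⁻ y, smearDensity σ (fun y => ρ y / 10) y z ∂m
      ≤ ∫⁻ y, (closedBall z (2 * ρ z)).indicator
          (fun _ => (ENNReal.ofReal (a * (ρ z / 11) ^ n))⁻¹) y ∂m := by
        refine lintegral_mono_ae ?_
        filter_upwards [hσ] with y hy
        by_cases hyz : z ∈ closedBall y (ρ y / 10)
        · have hdist : dist y z ≤ ρ y / 10 := mem_closedBall'.1 hyz
          have hyρ := hρ y z
          have hzρ := hρ z y
          rw [dist_comm] at hzρ
          rw [indicator_of_mem (mem_closedBall.2 (by linarith))]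
          refine (smearDensity_le y z).trans (ENNReal.inv_le_inv.2 (le_trans ?_ hy))
          gcongr ENNReal.ofReal (a * ?_ ^ n)
          linarith
        · rw [smearDensity, indicator_of_notMem hyz]
          exact zero_le
    _ = (ENNReal.ofReal (a * (ρ z / 11) ^ n))⁻¹ * m (closedBall z (2 * ρ z)) := by
        rw [lintegral_indicator isClosed_closedBall.measurableSet, setLIntegral_const]
    _ ≤ (ENNReal.ofReal (a * (ρ z / 11) ^ n))⁻¹ * ENNReal.ofReal (t * (2 * ρ z) ^ n) := by gcongr
    _ = ENNReal.ofReal (22 ^ n / a * t) := by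
        rw [← ENNReal.ofReal_inv_of_pos (by positivity), ← ENNReal.ofReal_mul (by positivity)]
        congr 1
        rw [show (22 : ℝ) = 2 * 11 by norm_num, mul_pow, mul_pow, div_pow]
        field_simp

/-- The stopping time argument: a point `x` outside the balls of `B` with `‖x - y‖ < ρ y / 5`
forces `ρ y < 2 * τ`, and then the truncation annihilates both kernels at `x`. -/
lemma IsCZKernel.exists_setLIntegral_truncKernel_sub_le_of_stopRadius (hk : IsCZKernel n k)
    (hμ : HasGrowth n μ) : ∃ A : ℝ≥0, ∀ (B : Set (Rd d × ℝ)) (s : Set (Rd d)) (τ ε : ℝ),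
      MeasurableSet s → (∀ p ∈ B, closedBall p.1 p.2 ⊆ s) → 0 < ε → τ ≤ ε / 8 → ∀ y z,
      0 < stopRadius B τ y → z ∈ closedBall y (stopRadius B τ y / 10) →
      ∫⁻ x in sᶜ, ‖truncKernel k ε x y - truncKernel k ε x z‖ₑ ∂μ ≤ A := by
  obtain ⟨A, hA⟩ := hk.exists_setLIntegral_truncKernel_sub_le hμ
  refine ⟨A, fun B s τ ε hs hBs hε hτ y z hy hz => ?_⟩
  set ρ := stopRadius B τ y
  have hyz : ‖y - z‖ ≤ ρ / 10 := by rwa [← dist_eq_norm, dist_comm]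
  refine le_trans ?_ (hA ε (ρ / 10) hε (by positivity) y z hyz)
  have hfar : MeasurableSet {x : Rd d | 2 * (ρ / 10) ≤ ‖x - y‖} :=
    (isClosed_le continuous_const (by fun_prop)).measurableSet
  rw [← lintegral_indicator hs.compl, ← lintegral_indicator hfar]
  refine lintegral_mono fun x => ?_
  by_cases hx : x ∈ s
  · rw [indicator_of_notMem (notMem_compl_iff.2 hx)]
    exact zero_le
  rcases le_or_gt (2 * (ρ / 10)) ‖x - y‖ with hxy | hxy
  · rw [indicator_of_mem (mem_compl hx), indicator_of_mem (by exact hxy)]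
  have hρτ : ρ / 2 < τ := by
    refine (lt_or_exists_of_lt_stopRadius (half_lt_self hy)).resolve_right ?_
    rintro ⟨p, hp, hlt⟩
    refine hx (hBs p hp (mem_closedBall.2 ?_))
    linarith [dist_triangle x y p.1, dist_eq_norm x y]
  have hxz := norm_sub_le_norm_sub_add_norm_sub x y z
  rw [indicator_of_mem (mem_compl hx), truncKernel_of_le (by linarith),
    truncKernel_of_le (by linarith), sub_self, enorm_zero]
  exact zero_le

lemma IsCZKernel.exists_setLIntegral_truncPos_sub_bind_smearKernel_le (hk : IsCZKernel n k)
    (hμ : HasGrowth n μ) {σ : Measure (Rd d)} [SFinite σ] :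
    ∃ A : ℝ≥0, ∀ (B : Set (Rd d × ℝ)) (s : Set (Rd d)) (τ ε : ℝ)
      (hρ : Measurable fun y => stopRadius B τ y / 10) (m : Measure (Rd d)) (_ : IsFiniteMeasure m),
      MeasurableSet s → (∀ p ∈ B, closedBall p.1 p.2 ⊆ s) → 0 < ε → τ ≤ ε / 8 →
      (∀ y, 0 < stopRadius B τ y) →
      ∫⁻ x in sᶜ, ‖truncPos k ε m x - truncPos k ε (m.bind (smearKernel σ hρ)) x‖ₑ ∂μ
        ≤ A * m univ := by
  have := hμ.isLocallyFiniteMeasure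
  obtain ⟨A, hA⟩ := hk.exists_setLIntegral_truncKernel_sub_le_of_stopRadius hμ
  refine ⟨A, fun B s τ ε hρ m _ hs hBs hε hτ hpos => ?_⟩
  refine hk.lintegral_truncPos_sub_bind_le hε (.of_forall fun y => ?_)
  refine hk.lintegral_truncKernel_sub_truncPos_le hε ?_
  filter_upwards [ae_smearKernel_mem_closedBall σ hρ (y := y) (by linarith [hpos y])] with z hz
  exact hA B s τ ε hs hBs hε hτ y z (hpos y) hz

section Concentrated

lemma exists_pow_eq (hn : n ≠ 0) {a : ℝ} (ha : 0 < a) : ∃ s : ℝ, 0 < s ∧ s ^ n = a :=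
  ⟨a ^ (n : ℝ)⁻¹, Real.rpow_pos_of_pos ha _, Real.rpow_inv_natCast_pow ha.le hn⟩

lemma IsCZKernel.exists_norm_truncPos_le (hk : IsCZKernel n k) : ∃ c : ℝ, 0 < c ∧
    ∀ (m : Measure (Rd d)) (_ : IsFiniteMeasure m) (x z : Rd d) (R ε : ℝ),
      m (closedBall z R)ᶜ = 0 → 0 < dist x z → 2 * R ≤ dist x z →
      ‖truncPos k ε m x‖ ≤ c / dist x z ^ n * m.real univ := by
  obtain ⟨c, hc, hsize⟩ := hk.exists_norm_truncKernel_le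
  refine ⟨c * 2 ^ n, by positivity, fun m _ x z R ε hm hxz hR => ?_⟩
  have hbound : ∀ᵐ y ∂m, ‖truncKernel k ε x y‖ ≤ c / (dist x z / 2) ^ n := by
    filter_upwards [mem_ae_iff.2 hm] with y hy
    refine hsize ε x y _ (half_pos hxz) fun _ => ?_
    rw [← dist_eq_norm]
    linarith [dist_triangle x y z, mem_closedBall.1 hy]
  refine (norm_integral_le_of_norm_le_const hbound).trans_eq ?_
  rw [div_pow, div_div_eq_mul_div]

lemma IsCZKernel.exists_measure_lt_le_of_concentrated (hk : IsCZKernel n k) (hμ : HasGrowth n μ)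
    (hn : n ≠ 0) : ∃ c : ℝ≥0, ∀ (m : Measure (Rd d)) (_ : IsFiniteMeasure m) (z : Rd d)
      (R t ε : ℝ), 0 < R → 0 < t → m (closedBall z R)ᶜ = 0 → t * R ^ n ≤ m.real univ →
      μ {x | t < ‖truncPos k ε m x‖} ≤ c / ENNReal.ofReal t * m univ := by
  obtain ⟨c, hc, hsize⟩ := hk.exists_norm_truncPos_le
  obtain ⟨c', hc', hμ⟩ := hμ
  refine ⟨(c' * (c + 2 ^ n)).toNNReal, fun m _ z R t ε hR ht hm hM => ?_⟩
  have hM0 : 0 < m.real univ := lt_of_lt_of_le (by positivity) hM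
  obtain ⟨s, hs, hsn⟩ := exists_pow_eq hn (a := (c + 2 ^ n) * m.real univ / t) (by positivity)
  have hRs : 2 * R ≤ s := by
    refine le_of_pow_le_pow_left₀ hn hs.le ?_
    rw [hsn, le_div_iff₀ ht, mul_pow]
    linarith [mul_le_mul_of_nonneg_left hM (by positivity : (0 : ℝ) ≤ 2 ^ n), mul_pos hc hM0]
  have hsub : {x | t < ‖truncPos k ε m x‖} ⊆ closedBall z s := fun x (hx : t < _) => by
    by_contra! hxz
    rw [mem_closedBall, not_le] at hxz
    refine hx.not_ge ?_
    calc ‖truncPos k ε m x‖ ≤ c / dist x z ^ n * m.real univ :=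
          hsize m ‹_› x z R ε hm (hs.trans hxz) (hRs.trans hxz.le)
      _ ≤ c / s ^ n * m.real univ := by gcongr
      _ = c / (c + 2 ^ n) * t := by
          rw [hsn]
          field_simp
      _ ≤ t := mul_le_of_le_one_left ht.le
          ((div_le_one (by positivity)).2 (le_add_of_nonneg_right (by positivity)))
  calc μ {x | t < ‖truncPos k ε m x‖} ≤ ENNReal.ofReal (c' * s ^ n) :=
        (measure_mono hsub).trans (hμ z s hs)
    _ = ENNReal.ofReal (c' * (c + 2 ^ n) / t * m.real univ) := by
        rw [hsn]
        congr 1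
        ring
    _ = (c' * (c + 2 ^ n)).toNNReal / ENNReal.ofReal t * m univ := by
        rw [ENNReal.ofReal_mul (by positivity), ENNReal.ofReal_div_of_pos ht, ofReal_measureReal]
        rfl

end Concentrated

/-- `σ` dominates the `n`-th power of the radius on the balls centred at `Γ`, up to the scale of the
diameter of `Γ`: the lower half of `n`-regularity, for a measure `σ` which need not be `H^n⌊Γ`. -/
def IsLowerRegularOn (n : ℕ) (σ : Measure (Rd d)) (Γ : Set (Rd d)) : Prop :=
  ∃ a : ℝ, 0 < a ∧ ∀ x ∈ Γ, ∀ r : ℝ, 0 < r → ENNReal.ofReal r ≤ ediam Γ →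
    ENNReal.ofReal (a * r ^ n) ≤ σ (closedBall x r)

section LowerRegular

variable {σ : Measure (Rd d)} [IsLocallyFiniteMeasure σ] {Γ : Set (Rd d)}

lemma mem_smearSet_of_ofReal_le {r : Rd d → ℝ} {y : Rd d} {a : ℝ} (ha : 0 < a)
    (h : ENNReal.ofReal a ≤ σ (closedBall y (r y))) : y ∈ smearSet σ r :=
  ⟨((ENNReal.ofReal_pos.2 ha).trans_le h).ne', measure_closedBall_lt_top.ne⟩

lemma BoundedL2.exists_lintegral_bind_smearKernel_sq_le (hT : BoundedL2 k σ μ) {a : ℝ}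
    (ha : 0 < a) : ∃ C : ℝ≥0, ∀ (m : Measure (Rd d)) (_ : IsFiniteMeasure m) (ρ : Rd d → ℝ)
      (hρm : Measurable fun y => ρ y / 10) (t ε : ℝ), 0 < t → 0 < ε → (∀ y, 0 < ρ y) →
      (∀ y z, ρ y ≤ ρ z + dist y z) →
      (∀ᵐ y ∂m, ENNReal.ofReal (a * (ρ y / 10) ^ n) ≤ σ (closedBall y (ρ y / 10))) →
      (∀ z, m (closedBall z (2 * ρ z)) ≤ ENNReal.ofReal (t * (2 * ρ z) ^ n)) →
      ∫⁻ x, ‖truncPos k ε (m.bind (smearKernel σ hρm)) x‖ₑ ^ 2 ∂μ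
        ≤ ENNReal.ofReal t * (C * m univ) := by
  obtain ⟨C, hC⟩ := hT.exists_lintegral_sq_le
  refine ⟨C * (22 ^ n / a).toNNReal, fun m _ ρ hρm t ε ht hε hρ0 hρ hσ hm => ?_⟩
  have hbind := bind_smearKernel (σ := σ) hρm (hσ.mono fun y hy =>
    have := hρ0 y
    mem_smearSet_of_ofReal_le (by positivity) hy)
  have hmass := measure_bind_univ m (smearKernel σ hρm)
  have hdensity : ∀ z, ∫⁻ y, smearDensity σ (fun y => ρ y / 10) y z ∂m
      ≤ ENNReal.ofReal (22 ^ n / a * t) :=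
    fun z => lintegral_smearDensity_le hρ0 hρ ha hσ (hm z)
  have hmeas : Measurable fun z => ∫⁻ y, smearDensity σ (fun y => ρ y / 10) y z ∂m :=
    ((measurable_smearDensity σ hρm).comp measurable_swap).lintegral_prod_right'
  rw [hbind] at hmass ⊢
  refine (hC ε hε _ hmeas _ ENNReal.ofReal_ne_top (.of_forall hdensity)
    (hmass.trans_ne (measure_ne_top _ _))).trans_eq ?_
  rw [hmass, mul_comm (22 ^ n / a) t, ENNReal.ofReal_mul ht.le, mul_left_comm, mul_assoc]
  rfl

lemma BoundedL2.exists_measure_lt_le_of_le_ediam (hT : BoundedL2 k σ μ) (hn : n ≠ 0)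
    (hk : IsCZKernel n k) (hμ : HasGrowth n μ) (hσ : IsLowerRegularOn n σ Γ) :
    ∃ c : ℝ≥0, ∀ (m : Measure (Rd d)) (_ : IsFiniteMeasure m) (R t ε : ℝ), m Γᶜ = 0 → 0 < R →
      0 < t → 0 < ε → ENNReal.ofReal R ≤ ediam Γ → m univ ≤ ENNReal.ofReal (t * R ^ n) →
      μ {x | t < ‖truncPos k ε m x‖} ≤ c / ENNReal.ofReal t * m univ := by
  have := hμ.isLocallyFiniteMeasure
  obtain ⟨a, ha, hσ⟩ := hσ
  obtain ⟨c, hcover⟩ := hμ.exists_measurableSet_heavyBalls_subset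
  obtain ⟨A, hA⟩ := hk.exists_setLIntegral_truncPos_sub_bind_smearKernel_le hμ (σ := σ)
  obtain ⟨C, hC⟩ := hT.exists_lintegral_bind_smearKernel_sq_le (n := n) ha
  refine ⟨c + 2 * A + 4 * C, fun m _ R t ε hmΓ hR ht hε hdiam hm => ?_⟩
  have hheavy : ∀ p ∈ heavyBalls n m t, p.2 ≤ R :=
    fun p hp => radius_le_of_mem_heavyBalls hn ht hR.le hm hp
  obtain ⟨E, hE, hballs, hμE⟩ := hcover m t R ht hheavy
  set τ := min (ε / 8) R
  set ρ := stopRadius (heavyBalls n m t) τ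
  have hρ0 (y : Rd d) : 0 < ρ y :=
    (lt_min (by positivity) hR).trans_le (le_stopRadius hheavy (Or.inl le_rfl))
  have hρ : ∀ y z, ρ y ≤ ρ z + dist y z := stopRadius_le_add_dist hheavy
  have hρm : Measurable fun y => ρ y / 10 :=
    (LipschitzWith.of_le_add hρ).continuous.measurable.div_const 10
  have hlower : ∀ᵐ y ∂m, ENNReal.ofReal (a * (ρ y / 10) ^ n) ≤ σ (closedBall y (ρ y / 10)) := by
    filter_upwards [mem_ae_iff.2 hmΓ] with y hy
    have hρR : ρ y ≤ R := stopRadius_le (min_le_right _ _) hheavy y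
    exact hσ y hy _ (by linarith [hρ0 y])
      ((ENNReal.ofReal_le_ofReal (by linarith [hρ0 y])).trans hdiam)
  have hlight (z : Rd d) : m (closedBall z (2 * ρ z)) ≤ ENNReal.ofReal (t * (2 * ρ z) ^ n) := by
    have hz := hρ0 z
    by_contra! h
    exact notMem_of_stopRadius_lt hheavy (lt_two_mul_self hz) ⟨by positivity, h⟩
  set κ := smearKernel σ hρm
  have hgood : μ {x | t / 2 < ‖truncPos k ε (m.bind κ) x‖} ≤ 4 * (C * m univ / ENNReal.ofReal t) :=
    measure_half_lt_norm_le_of_lintegral_sq_le (hk.measurable_truncPos hε _).enorm.aemeasurable ht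
      (hC m ‹_› ρ hρm t ε ht hε hρ0 hρ hlower hlight)
  have hbad : ∫⁻ x in Eᶜ, ‖truncPos k ε m x - truncPos k ε (m.bind κ) x‖ₑ ∂μ ≤ A * m univ :=
    hA _ E τ ε hρm m ‹_› hE hballs hε (min_le_left _ _) hρ0
  have hmeas := (hk.measurable_truncPos hε m).sub (hk.measurable_truncPos hε (m.bind κ))
  refine (measure_lt_norm_le_add_of_setLIntegral_compl hE hmeas.enorm.aemeasurable ht).trans
    ((add_le_add_three hμE (mul_le_mul' le_rfl (ENNReal.div_le_div_right hbad _))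
      hgood).trans_eq ?_)
  simp only [div_eq_mul_inv]
  push_cast
  ring

theorem BoundedL2.boundedWeakL1Pos (hT : BoundedL2 k σ μ) (hn : n ≠ 0) (hk : IsCZKernel n k)
    (hμ : HasGrowth n μ) (hσ : IsLowerRegularOn n σ Γ) : BoundedWeakL1Pos k Γ μ := by
  obtain ⟨c₁, hsmall⟩ := hk.exists_measure_lt_le_of_concentrated hμ hn
  obtain ⟨c₂, hlarge⟩ := hT.exists_measure_lt_le_of_le_ediam hn hk hμ hσ
  refine ⟨max c₁ c₂, fun m _ hm t ht ε hε => ?_⟩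
  rcases eq_zero_or_neZero m with rfl | _
  · simp [truncPos, ht.not_gt]
  have hM : 0 < m.real univ := measureReal_univ_pos
  obtain ⟨R, hR, hRn⟩ := exists_pow_eq hn (div_pos hM ht)
  have htR : t * R ^ n = m.real univ := by rw [hRn, mul_div_cancel₀ _ ht.ne']
  rcases le_total (ediam Γ) (ENNReal.ofReal R) with hdiam | hdiam
  · obtain ⟨z, hz⟩ : Γ.Nonempty := by
      by_contra! hΓ
      exact NeZero.ne m (by simpa [hΓ] using hm)
    have hsub : Γ ⊆ closedBall z R := fun y hy => by
      rw [mem_closedBall, ← edist_le_ofReal hR.le]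
      exact (edist_le_ediam_of_mem hy hz).trans hdiam
    refine (hsmall m ‹_› z R t ε hR ht (measure_mono_null (compl_subset_compl.2 hsub) hm)
      htR.le).trans ?_
    gcongr
    exact le_max_left _ _
  · refine (hlarge m ‹_› R t ε hm hR ht hε hdiam ?_).trans ?_
    · rw [htR, ofReal_measureReal]
    · gcongr
      exact le_max_right _ _

end LowerRegular

/-! ### The weak type inequality off a domain -/

section CarryingSets

variable {S T Γ : Set (Rd d)}

lemma BoundedWeakL1Pos.union (hS : BoundedWeakL1Pos k S μ) (hT : BoundedWeakL1Pos k T μ)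
    (hk : IsCZKernel n k) (hSm : MeasurableSet S) : BoundedWeakL1Pos k (S ∪ T) μ := by
  obtain ⟨c, hc⟩ := hS
  obtain ⟨c', hc'⟩ := hT
  refine ⟨2 * (c + c'), fun m _ hm t ht ε hε => ?_⟩
  have hmS : m.restrict S Sᶜ = 0 := by
    rw [Measure.restrict_apply' hSm, compl_inter_self, measure_empty]
  have hmT : m.restrict Sᶜ Tᶜ = 0 := by
    rwa [Measure.restrict_apply' hSm.compl, inter_comm, ← compl_union]
  have hsplit (x : Rd d) :
      truncPos k ε m x = truncPos k ε (m.restrict S) x + truncPos k ε (m.restrict Sᶜ) x :=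
    (integral_add_compl hSm (hk.integrable_truncKernel hε x m)).symm
  simp_rw [hsplit]
  calc _ ≤ _ := measure_lt_norm_add_le μ _ _ t
    _ ≤ c / ENNReal.ofReal (t / 2) * m univ + c' / ENNReal.ofReal (t / 2) * m univ := by
        refine add_le_add ((hc _ inferInstance hmS _ (half_pos ht) ε hε).trans ?_)
          ((hc' _ inferInstance hmT _ (half_pos ht) ε hε).trans ?_) <;>
        · gcongr
          exact Measure.restrict_le_self
    _ = _ := by
        rw [div_ofReal_half, div_ofReal_half]
        simp only [div_eq_mul_inv]
        push_cast
        ring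

lemma IsCZKernel.boundedWeakL1Pos_of_lintegral_le [SFinite μ] (hk : IsCZKernel n k) {A : ℝ≥0}
    (h : ∀ ε : ℝ, 0 < ε → ∀ y ∈ S, ∫⁻ x, ‖truncKernel k ε x y‖ₑ ∂μ ≤ A) :
    BoundedWeakL1Pos k S μ := by
  refine ⟨A, fun m _ hm t ht ε hε => ?_⟩
  have hmS : ∀ᵐ y ∂m, y ∈ S := mem_ae_iff.2 hm
  have hL1 : ∫⁻ x, ‖truncPos k ε m x‖ₑ ∂μ ≤ A * m univ :=
    calc ∫⁻ x, ‖truncPos k ε m x‖ₑ ∂μ ≤ ∫⁻ x, ∫⁻ y, ‖truncKernel k ε x y‖ₑ ∂m ∂μ :=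
          lintegral_mono fun x => enorm_integral_le_lintegral_enorm _
      _ = ∫⁻ y, ∫⁻ x, ‖truncKernel k ε x y‖ₑ ∂μ ∂m :=
          lintegral_lintegral_swap (hk.measurable_truncKernel hε).enorm.aemeasurable
      _ ≤ ∫⁻ _, A ∂m := lintegral_mono_ae (hmS.mono (h ε hε))
      _ = A * m univ := lintegral_const _
  have hcheb := measure_lt_norm_le_lintegral_pow_div 1
    (hk.measurable_truncPos hε m).enorm.aemeasurable ht (ν := μ)
  simp only [pow_one] at hcheb
  exact (hcheb.trans (ENNReal.div_le_div_right hL1 _)).trans_eq ENNReal.mul_div_right_comm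

lemma BoundedWeakL1Pos.of_kernel [SFinite μ] (hΓ : BoundedWeakL1Pos k Γ μ) (hk : IsCZKernel n k)
    (hΓm : MeasurableSet Γ) (κ : Kernel (Rd d) (Rd d)) [IsMarkovKernel κ]
    (hκ : ∀ y ∈ S, κ y Γᶜ = 0) {A : ℝ≥0}
    (hA : ∀ ε : ℝ, 0 < ε → ∀ y ∈ S,
      ∫⁻ x, ‖truncKernel k ε x y - truncPos k ε (κ y) x‖ₑ ∂μ ≤ A) :
    BoundedWeakL1Pos k S μ := by
  obtain ⟨c, hc⟩ := hΓ
  refine ⟨2 * A + 2 * c, fun m _ hm t ht ε hε => ?_⟩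
  have hmS : ∀ᵐ y ∂m, y ∈ S := mem_ae_iff.2 hm
  have hcarried : m.bind κ Γᶜ = 0 := by
    rw [Measure.bind_apply hΓm.compl κ.aemeasurable,
      lintegral_eq_zero_iff (κ.measurable_coe hΓm.compl)]
    exact hmS.mono hκ
  have hswept : μ {x | t / 2 < ‖truncPos k ε (m.bind κ) x‖}
      ≤ 2 * (c / ENNReal.ofReal t) * m univ := by
    rw [← div_ofReal_half, ← measure_bind_univ m κ]
    exact hc _ inferInstance hcarried _ (half_pos ht) ε hε
  have hL1 : ∫⁻ x in ∅ᶜ, ‖truncPos k ε m x - truncPos k ε (m.bind κ) x‖ₑ ∂μ ≤ A * m univ := by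
    rw [compl_empty, Measure.restrict_univ]
    exact hk.lintegral_truncPos_sub_bind_le hε (hmS.mono (hA ε hε))
  have hmeas := (hk.measurable_truncPos hε m).sub (hk.measurable_truncPos hε (m.bind κ))
  refine (measure_lt_norm_le_add_of_setLIntegral_compl .empty hmeas.enorm.aemeasurable ht).trans
    ((add_le_add_three measure_empty.le
      (mul_le_mul' le_rfl (ENNReal.div_le_div_right hL1 _)) hswept).trans_eq ?_)
  simp only [div_eq_mul_inv]
  push_cast
  ring

end CarryingSets

section Sweep

lemma IsCZKernel.exists_setLIntegral_closedBall_le (hk : IsCZKernel n k) (hμ : HasGrowth n μ)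
    {b : ℝ} (hb : 0 < b) : ∃ A : ℝ≥0, ∀ (ε : ℝ) (y z : Rd d) (δ : ℝ), 0 < δ →
      (∀ᵐ x ∂μ, δ ≤ dist x y) → ∫⁻ x in closedBall z (b * δ), ‖truncKernel k ε x y‖ₑ ∂μ ≤ A := by
  obtain ⟨c, hc, hsize⟩ := hk.exists_norm_truncKernel_le
  obtain ⟨c', hc', hμ⟩ := hμ
  refine ⟨(c * (c' * b ^ n)).toNNReal, fun ε y z δ hδ hxy => ?_⟩
  calc ∫⁻ x in closedBall z (b * δ), ‖truncKernel k ε x y‖ₑ ∂μ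
      ≤ ∫⁻ _ in closedBall z (b * δ), ENNReal.ofReal (c / δ ^ n) ∂μ := by
        refine lintegral_mono_ae ?_
        filter_upwards [ae_restrict_of_ae hxy] with x hx
        rw [← ofReal_norm]
        exact ENNReal.ofReal_le_ofReal
          (hsize ε x y δ hδ fun _ => hx.trans_eq (dist_eq_norm _ _))
    _ ≤ ENNReal.ofReal (c / δ ^ n) * ENNReal.ofReal (c' * (b * δ) ^ n) := by
        rw [setLIntegral_const]
        gcongr
        exact hμ z _ (by positivity)
    _ = (c * (c' * b ^ n)).toNNReal := by
        rw [← ENNReal.ofReal_mul (by positivity), mul_pow,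
          show c / δ ^ n * (c' * (b ^ n * δ ^ n)) = c * (c' * b ^ n) by field_simp]
        rfl

lemma le_add_inv_mul_sq {b β : ℝ≥0∞} (h0 : β ≠ 0) (h1 : β ≠ ∞) : b ≤ β + β⁻¹ * b ^ 2 := by
  rcases le_total b β with h | h
  · exact h.trans le_self_add
  · refine le_trans ?_ le_add_self
    calc b = β⁻¹ * (β * b) := by rw [← mul_assoc, ENNReal.inv_mul_cancel h0 h1, one_mul]
      _ ≤ β⁻¹ * b ^ 2 := by
          rw [sq]
          gcongr

lemma setLIntegral_enorm_le_add_inv_mul_lintegral_sq {X F : Type*} [MeasurableSpace X]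
    [NormedAddCommGroup F] (ν : Measure X) (f : X → F) (s : Set X) {β : ℝ≥0∞} (h0 : β ≠ 0)
    (h1 : β ≠ ∞) : ∫⁻ x in s, ‖f x‖ₑ ∂ν ≤ β * ν s + β⁻¹ * ∫⁻ x, ‖f x‖ₑ ^ 2 ∂ν :=
  calc ∫⁻ x in s, ‖f x‖ₑ ∂ν ≤ ∫⁻ x in s, (β + β⁻¹ * ‖f x‖ₑ ^ 2) ∂ν :=
        lintegral_mono fun x => le_add_inv_mul_sq h0 h1
    _ = β * ν s + β⁻¹ * ∫⁻ x in s, ‖f x‖ₑ ^ 2 ∂ν := by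
        rw [lintegral_add_left measurable_const, setLIntegral_const,
          lintegral_const_mul' _ _ (ENNReal.inv_ne_top.2 h0)]
    _ ≤ β * ν s + β⁻¹ * ∫⁻ x, ‖f x‖ₑ ^ 2 ∂ν := by
        gcongr
        exact Measure.restrict_le_self

variable {σ : Measure (Rd d)} {Γ : Set (Rd d)}

lemma IsLowerRegularOn.exists_ofReal_le_measure_closedBall (hσ : IsLowerRegularOn n σ Γ)
    (hΓ : IsClosed Γ) (hne : Γ.Nonempty) : ∃ a : ℝ, 0 < a ∧ ∀ y : Rd d, 0 < infDist y Γ →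
      ENNReal.ofReal (infDist y Γ) ≤ ediam Γ →
      ENNReal.ofReal (a * infDist y Γ ^ n) ≤ σ (closedBall y (2 * infDist y Γ)) := by
  obtain ⟨a, ha, hσ⟩ := hσ
  refine ⟨a, ha, fun y hδ hdiam => ?_⟩
  obtain ⟨w, hw, hwd⟩ := hΓ.exists_infDist_eq_dist hne y
  exact (hσ w hw _ hδ hdiam).trans (measure_mono (closedBall_subset_closedBall'
    (by rw [dist_comm w, ← hwd, two_mul])))

variable [IsLocallyFiniteMeasure σ]

/-- The Markov kernel that sweeps point masses onto `Γ`: the one at `y` is spread evenly over the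
part of `σ` within twice the distance from `y` to `Γ`. Points of `Γ` get radius `0`, hence stay. -/
abbrev sweepKernel (σ : Measure (Rd d)) [SFinite σ] (Γ : Set (Rd d)) : Kernel (Rd d) (Rd d) :=
  smearKernel σ (r := fun y => 2 * infDist y Γ) ((continuous_infDist_pt Γ).measurable.const_mul 2)

lemma ae_sweepKernel_eq {y : Rd d} (hy : y ∈ Γ) : ∀ᵐ z ∂(sweepKernel σ Γ y), z = y := by
  have hzero := infDist_zero_of_mem hy
  filter_upwards [ae_smearKernel_mem_closedBall σ
    ((continuous_infDist_pt Γ).measurable.const_mul 2) (y := y) (by simp [hzero])] with z hz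
  simpa [hzero] using hz

lemma sweepKernel_compl (hσ : IsLowerRegularOn n σ Γ) (hΓ : IsClosed Γ) (hne : Γ.Nonempty)
    (hσΓ : σ Γᶜ = 0) {y : Rd d} (hdiam : ENNReal.ofReal (infDist y Γ) ≤ ediam Γ) :
    sweepKernel σ Γ y Γᶜ = 0 := by
  obtain ⟨a, ha, hlower⟩ := hσ.exists_ofReal_le_measure_closedBall hΓ hne
  by_cases hy : y ∈ Γ
  · exact mem_ae_iff.1 ((ae_sweepKernel_eq hy).mono fun z hz => show z ∈ Γ by rwa [hz])
  · have hδ := (hΓ.notMem_iff_infDist_pos hne).1 hy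
    rw [smearKernel_of_mem _ (mem_smearSet_of_ofReal_le (by positivity) (hlower y hδ hdiam))]
    exact withDensity_absolutelyContinuous _ _ hσΓ

lemma BoundedL2.exists_setLIntegral_truncPos_sweepKernel_le (hT : BoundedL2 k σ μ)
    (hμ : HasGrowth n μ) (hσ : IsLowerRegularOn n σ Γ) (hΓ : IsClosed Γ) (hne : Γ.Nonempty) :
    ∃ A : ℝ≥0, ∀ ε : ℝ, 0 < ε → ∀ y : Rd d, 0 < infDist y Γ →
      ENNReal.ofReal (infDist y Γ) ≤ ediam Γ →
      ∫⁻ x in closedBall y (4 * infDist y Γ), ‖truncPos k ε (sweepKernel σ Γ y) x‖ₑ ∂μ ≤ A := by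
  obtain ⟨a, ha, hlower⟩ := hσ.exists_ofReal_le_measure_closedBall hΓ hne
  obtain ⟨C, hC⟩ := hT.exists_lintegral_smearKernel_sq_le
  obtain ⟨c, hc, hμ⟩ := hμ
  refine ⟨(c * 4 ^ n).toNNReal + C * a⁻¹.toNNReal, fun ε hε y hδ hdiam => ?_⟩
  have hmem : y ∈ smearSet σ fun y => 2 * infDist y Γ :=
    mem_smearSet_of_ofReal_le (by positivity) (hlower y hδ hdiam)
  -- AM-GM with the scale-invariant weight `δ ^ (-n)`, `δ` being the distance from `y` to `Γ`
  set β : ℝ≥0∞ := ENNReal.ofReal (infDist y Γ ^ n)⁻¹ with hβ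
  have hβ0 : β ≠ 0 := (ENNReal.ofReal_pos.2 (by positivity)).ne'
  have hβi : β⁻¹ = ENNReal.ofReal (infDist y Γ ^ n) := by
    rw [hβ, ENNReal.ofReal_inv_of_pos (by positivity), inv_inv]
  have hball : β * μ (closedBall y (4 * infDist y Γ)) ≤ ENNReal.ofReal (c * 4 ^ n) := by
    refine (mul_le_mul' le_rfl (hμ y _ (by positivity))).trans_eq ?_
    rw [hβ, ← ENNReal.ofReal_mul (by positivity), mul_pow]
    congr 1
    field_simp
  have hsq : β⁻¹ * ∫⁻ x, ‖truncPos k ε (sweepKernel σ Γ y) x‖ₑ ^ 2 ∂μ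
      ≤ C * ENNReal.ofReal a⁻¹ :=
    calc _ ≤ β⁻¹ * (C * (ENNReal.ofReal (a * infDist y Γ ^ n))⁻¹) := by
          gcongr
          exact (hC ε hε _ _ y hmem).trans (by gcongr; exact hlower y hδ hdiam)
      _ = C * ENNReal.ofReal a⁻¹ := by
          rw [hβi, ← ENNReal.ofReal_inv_of_pos (by positivity), mul_left_comm,
            ← ENNReal.ofReal_mul (by positivity)]
          congr 2
          field_simp
  exact (setLIntegral_enorm_le_add_inv_mul_lintegral_sq μ _ _ hβ0 ENNReal.ofReal_ne_top).trans
    (add_le_add hball hsq)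

lemma BoundedL2.exists_lintegral_truncKernel_sub_sweepKernel_le (hT : BoundedL2 k σ μ)
    (hk : IsCZKernel n k) (hμ : HasGrowth n μ) (hσ : IsLowerRegularOn n σ Γ) (hΓ : IsClosed Γ)
    (hne : Γ.Nonempty) : ∃ A : ℝ≥0, ∀ ε : ℝ, 0 < ε → ∀ y : Rd d,
      ENNReal.ofReal (infDist y Γ) ≤ ediam Γ → (∀ᵐ x ∂μ, infDist y Γ ≤ dist x y) →
      ∫⁻ x, ‖truncKernel k ε x y - truncPos k ε (sweepKernel σ Γ y) x‖ₑ ∂μ ≤ A := by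
  have := hμ.isLocallyFiniteMeasure
  obtain ⟨A₁, hfar⟩ := hk.exists_setLIntegral_truncKernel_sub_le hμ
  obtain ⟨A₂, hkernel⟩ := hk.exists_setLIntegral_closedBall_le hμ four_pos
  obtain ⟨A₃, hswept⟩ := hT.exists_setLIntegral_truncPos_sweepKernel_le hμ hσ hΓ hne
  refine ⟨A₁ + (A₂ + A₃), fun ε hε y hdiam hxy => ?_⟩
  by_cases hy : y ∈ Γ
  · refine hk.lintegral_truncKernel_sub_truncPos_le hε ((ae_sweepKernel_eq hy).mono fun z hz => ?_)
    simp [hz]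
  have hδ := (hΓ.notMem_iff_infDist_pos hne).1 hy
  set δ := infDist y Γ
  set κ := sweepKernel σ Γ
  have hcover : {x | 2 * (2 * δ) ≤ ‖x - y‖} ∪ closedBall y (4 * δ) = univ := by
    refine eq_univ_of_forall fun x => ?_
    rw [mem_union, mem_ofPred_eq, mem_closedBall, dist_eq_norm,
      show 2 * (2 * δ) = 4 * δ by ring]
    exact le_total _ _
  calc _ ≤ ∫⁻ x in {x | 2 * (2 * δ) ≤ ‖x - y‖}, ‖truncKernel k ε x y - truncPos k ε (κ y) x‖ₑ ∂μ
        + ∫⁻ x in closedBall y (4 * δ), (‖truncKernel k ε x y‖ₑ + ‖truncPos k ε (κ y) x‖ₑ) ∂μ := by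
        rw [← setLIntegral_univ, ← hcover]
        exact (lintegral_union_le _ _ _).trans
          (add_le_add le_rfl (lintegral_mono fun x => enorm_sub_le))
    _ ≤ A₁ + (A₂ + A₃) := by
        rw [lintegral_add_left (hk.measurable_truncKernel_left hε y).enorm]
        refine add_le_add (hk.lintegral_truncKernel_sub_truncPos_le hε ?_)
          (add_le_add (hkernel ε y y δ hδ hxy) (hswept ε hε y hδ hdiam))
        filter_upwards [ae_smearKernel_mem_closedBall σ
          ((continuous_infDist_pt Γ).measurable.const_mul 2) (y := y) (by positivity)] with z hz
        exact hfar ε (2 * δ) hε (by positivity) y z (by rwa [← dist_eq_norm, dist_comm])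

theorem BoundedL2.boundedWeakL1Pos_of_infDist_le_dist (hT : BoundedL2 k σ μ) (hn : n ≠ 0)
    (hk : IsCZKernel n k) (hμ : HasGrowth n μ) (hσ : IsLowerRegularOn n σ Γ) (hΓ : IsClosed Γ)
    (hne : Γ.Nonempty) (hσΓ : σ Γᶜ = 0) :
    BoundedWeakL1Pos k
      {y | ENNReal.ofReal (infDist y Γ) ≤ ediam Γ ∧ ∀ᵐ x ∂μ, infDist y Γ ≤ dist x y} μ := by
  have := hμ.isLocallyFiniteMeasure
  obtain ⟨A, hA⟩ := hT.exists_lintegral_truncKernel_sub_sweepKernel_le hk hμ hσ hΓ hne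
  exact (hT.boundedWeakL1Pos hn hk hμ hσ).of_kernel hk hΓ.measurableSet (sweepKernel σ Γ)
    (fun y hy => sweepKernel_compl hσ hΓ hne hσΓ hy.1) fun ε hε y hy => hA ε hε y hy.1 hy.2

end Sweep

section Frontier

lemma subset_interior_of_disjoint_frontier {X : Type*} [TopologicalSpace X] {s U : Set X}
    (hs : IsPreconnected s) (hsU : Disjoint s (frontier U)) (hne : (s ∩ closure U).Nonempty) :
    s ⊆ interior U := by
  have hclosure : ∀ x ∈ s, x ∈ closure U → x ∈ interior U := fun x hxs hx => by
    by_contra hxU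
    exact disjoint_left.1 hsU hxs ⟨hx, hxU⟩
  obtain ⟨x₀, hx₀, hx₀U⟩ := hne
  refine hs.subset_left_of_subset_union isOpen_interior isClosed_closure.isOpen_compl
    (disjoint_compl_right.mono_left (interior_subset.trans subset_closure)) (fun x hx => ?_)
    ⟨x₀, hx₀, hclosure x₀ hx₀ hx₀U⟩
  exact (em (x ∈ closure U)).imp_left (hclosure x hx)

variable {E : Type*} [NormedAddCommGroup E] [NormedSpace ℝ E] {U : Set E}

lemma infDist_frontier_le_dist {x y : E} (hx : x ∈ closure U) (hy : y ∉ U) :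
    infDist y (frontier U) ≤ dist x y := by
  by_contra! hlt
  have hsub : segment ℝ y x ⊆ interior U := by
    refine subset_interior_of_disjoint_frontier (convex_segment y x).isPreconnected
      (disjoint_left.2 fun w hw hwU => ?_) ⟨x, right_mem_segment ℝ y x, hx⟩
    refine hlt.not_ge ((infDist_le_dist_of_mem hwU).trans ?_)
    rw [dist_comm y w, dist_comm x y]
    exact segment_subset_closedBall_left y x hw
  exact hy (interior_subset (hsub (left_mem_segment ℝ y x)))

lemma isPreconnected_compl_closedBall (hE : 1 < Module.rank ℝ E) (z : E) {R : ℝ} (hR : 0 ≤ R) :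
    IsPreconnected (closedBall z R)ᶜ := by
  have hpolar : (closedBall z R)ᶜ
      = (fun p : E × ℝ => z + p.2 • p.1) '' (sphere 0 1 ×ˢ Ioi R) := by
    ext x
    simp only [mem_compl_iff, mem_closedBall, not_le, mem_image, mem_prod,
      mem_sphere_zero_iff_norm, mem_Ioi, Prod.exists]
    constructor
    · intro hx
      rw [dist_eq_norm] at hx
      have hpos : 0 < ‖x - z‖ := hR.trans_lt hx
      refine ⟨‖x - z‖⁻¹ • (x - z), ‖x - z‖, ⟨?_, hx⟩, ?_⟩
      · rw [norm_smul, norm_inv, norm_norm, inv_mul_cancel₀ hpos.ne']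
      · rw [smul_smul, mul_inv_cancel₀ hpos.ne', one_smul, add_sub_cancel]
    · rintro ⟨u, s, ⟨hu, hs⟩, rfl⟩
      rwa [dist_eq_norm, add_sub_cancel_left, norm_smul, hu, mul_one,
        Real.norm_of_nonneg (hR.trans hs.le)]
  rw [hpolar]
  exact ((isPreconnected_sphere hE 0 1).prod isPreconnected_Ioi).image _
    (by fun_prop : Continuous fun p : E × ℝ => z + p.2 • p.1).continuousOn

lemma closure_subset_closedBall_of_ediam_frontier_lt (hE : 1 < Module.rank ℝ E) {y z : E}
    (hy : y ∉ U) (hz : z ∈ frontier U)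
    (hlt : ediam (frontier U) < ENNReal.ofReal (infDist y (frontier U))) :
    closure U ⊆ closedBall z (infDist y (frontier U)) := by
  set R := (ediam (frontier U)).toReal
  have hR : R < infDist y (frontier U) :=
    (ENNReal.lt_ofReal_iff_toReal_lt hlt.ne_top).1 hlt
  have hfrontier : frontier U ⊆ closedBall z R := fun w hw => by
    rw [mem_closedBall, dist_edist]
    exact ENNReal.toReal_mono hlt.ne_top (edist_le_ediam_of_mem hw hz)
  have hyR : y ∈ (closedBall z R)ᶜ := by
    rw [mem_compl_iff, mem_closedBall, not_le]
    exact hR.trans_le (infDist_le_dist_of_mem hz)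
  -- otherwise the complement of the ball, being connected, would lie in `U` together with `y`
  refine Subset.trans (fun x hx => ?_) (closedBall_subset_closedBall hR.le)
  by_contra hxR
  exact hy (interior_subset (subset_interior_of_disjoint_frontier
    (isPreconnected_compl_closedBall hE z ENNReal.toReal_nonneg)
    (disjoint_compl_left.mono_right hfrontier) ⟨x, hxR, hx⟩ hyR))

end Frontier

lemma HasGrowth.isFiniteMeasure (hμ : HasGrowth 0 μ) : IsFiniteMeasure μ := by
  obtain ⟨c, -, hμ⟩ := hμ
  have hball (i : ℕ) : μ (closedBall 0 i) ≤ ENNReal.ofReal c :=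
    (measure_mono (closedBall_subset_closedBall (le_add_of_nonneg_right zero_le_one))).trans
      ((hμ 0 (i + 1) (by positivity)).trans_eq (by rw [pow_zero, mul_one]))
  refine ⟨lt_of_le_of_lt ?_ (ENNReal.ofReal_lt_top (r := c))⟩
  rw [← iUnion_closedBall_nat (0 : Rd d), Monotone.measure_iUnion
    fun i j hij => closedBall_subset_closedBall (Nat.cast_le.2 hij)]
  exact iSup_le hball

lemma IsCZKernel.boundedWeakL1Pos_of_dim_zero (hk : IsCZKernel 0 k) (hμ : HasGrowth 0 μ)
    (S : Set (Rd d)) : BoundedWeakL1Pos k S μ := by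
  have := hμ.isFiniteMeasure
  obtain ⟨c, -, hsize⟩ := hk.exists_norm_truncKernel_le
  refine hk.boundedWeakL1Pos_of_lintegral_le (A := c.toNNReal * (μ univ).toNNReal)
    fun ε hε y _ => ?_
  calc ∫⁻ x, ‖truncKernel k ε x y‖ₑ ∂μ ≤ ∫⁻ _, ENNReal.ofReal c ∂μ := lintegral_mono fun x => by
        rw [← ofReal_norm]
        exact ENNReal.ofReal_le_ofReal (by simpa using hsize ε x y ε hε le_of_lt)
    _ = _ := by
        rw [lintegral_const, ENNReal.coe_mul, ENNReal.coe_toNNReal (measure_ne_top μ univ)]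
        rfl

section Domain

variable {U : Set (Rd d)}

lemma IsCZKernel.boundedWeakL1Pos_of_ediam_frontier_lt (hk : IsCZKernel n k)
    (hμ : HasGrowth n μ) (hd : 2 ≤ d) (hU : (frontier U).Nonempty) (hμU : μ (closure U)ᶜ = 0) :
    BoundedWeakL1Pos k
      (Uᶜ ∩ {y | ediam (frontier U) < ENNReal.ofReal (infDist y (frontier U))}) μ := by
  have := hμ.isLocallyFiniteMeasure
  have hrank : 1 < Module.rank ℝ (Rd d) := by
    rw [← Module.finrank_eq_rank, finrank_euclideanSpace_fin]
    exact_mod_cast hd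
  obtain ⟨z, hz⟩ := hU
  obtain ⟨A, hA⟩ := hk.exists_setLIntegral_closedBall_le hμ one_pos
  refine hk.boundedWeakL1Pos_of_lintegral_le (A := A) fun ε _ y ⟨hyU, hy⟩ => ?_
  set δ := infDist y (frontier U)
  have hδ : 0 < δ := ENNReal.ofReal_pos.1 (zero_le.trans_lt hy)
  have hclosure : ∀ᵐ x ∂μ, x ∈ closure U := mem_ae_iff.2 hμU
  have hball : ∀ᵐ x ∂μ, x ∈ closedBall z (1 * δ) := hclosure.mono fun x hx => by
    rw [one_mul]
    exact closure_subset_closedBall_of_ediam_frontier_lt hrank hyU hz hy hx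
  rw [← setLIntegral_univ, ← setLIntegral_congr (ae_eq_univ.2 (mem_ae_iff.1 hball))]
  exact hA ε y z δ hδ (hclosure.mono fun x hx => infDist_frontier_le_dist hx hyU)

lemma BoundedWeakL1Pos.mono {S T : Set (Rd d)} (h : BoundedWeakL1Pos k T μ) (hST : S ⊆ T) :
    BoundedWeakL1Pos k S μ := by
  obtain ⟨c, hc⟩ := h
  exact ⟨c, fun m _ hm => hc m ‹_› (measure_mono_null (compl_subset_compl.2 hST) hm)⟩

variable {σ : Measure (Rd d)} [IsLocallyFiniteMeasure σ]

theorem BoundedL2.boundedWeakL1Pos_compl (hT : BoundedL2 k σ μ) (hn : n ≠ 0) (hd : 2 ≤ d)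
    (hk : IsCZKernel n k) (hμ : HasGrowth n μ) (hU : IsOpen U) (hne : U.Nonempty)
    (hμU : μ (closure U)ᶜ = 0) (hσ : IsLowerRegularOn n σ (frontier U))
    (hσU : σ (frontier U)ᶜ = 0) : BoundedWeakL1Pos k Uᶜ μ := by
  have := hμ.isLocallyFiniteMeasure
  rcases (frontier U).eq_empty_or_nonempty with hempty | hΓ
  · obtain rfl : U = univ := (frontier_eq_empty_iff.1 hempty).resolve_left hne.ne_empty
    exact hk.boundedWeakL1Pos_of_lintegral_le (A := 0) (by simp)
  set far := Uᶜ ∩ {y | ediam (frontier U) < ENNReal.ofReal (infDist y (frontier U))}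
  have hfar : MeasurableSet far := hU.measurableSet.compl.inter
    (measurableSet_lt measurable_const (continuous_infDist_pt _).measurable.ennreal_ofReal)
  refine ((hk.boundedWeakL1Pos_of_ediam_frontier_lt hμ hd hΓ hμU).union
    (hT.boundedWeakL1Pos_of_infDist_le_dist hn hk hμ hσ isClosed_frontier hΓ hσU) hk hfar).mono
    fun y hy => ?_
  rcases lt_or_ge (ediam (frontier U)) (ENNReal.ofReal (infDist y (frontier U))) with h | h
  · exact Or.inl ⟨hy, h⟩
  · have hclosure : ∀ᵐ x ∂μ, x ∈ closure U := mem_ae_iff.2 hμU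
    exact Or.inr ⟨h, hclosure.mono fun x hx => infDist_frontier_le_dist hx hy⟩

end Domain

section Regular

variable {Γ : Set (Rd d)}

lemma hausdorffOn_apply {s : Set (Rd d)} (hs : MeasurableSet s) :
    hausdorffOn n Γ s = Measure.hausdorffMeasure (n : ℝ) (s ∩ Γ) :=
  Measure.restrict_apply hs

lemma hausdorffMeasure_lt_top_of_subsingleton {s : Set (Rd d)} (hs : s.Subsingleton) :
    Measure.hausdorffMeasure (n : ℝ) s < ∞ := by
  rcases n.eq_zero_or_pos with rfl | hn
  · rcases hs.eq_empty_or_singleton with rfl | ⟨x, rfl⟩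
    · simp
    · simp [Measure.hausdorffMeasure_zero_singleton]
  · have := Measure.nullSingletonClass_hausdorff (Rd d) (d := n) (by positivity)
    rw [hs.measure_zero]
    exact ENNReal.zero_lt_top

lemma IsADRegularSet.hausdorffOn_closedBall_lt_top (hΓ : IsADRegularSet n Γ) {x : Rd d}
    (hx : x ∈ Γ) {r : ℝ} (hr : 0 < r) : hausdorffOn n Γ (closedBall x r) < ∞ := by
  obtain ⟨c, -, hc⟩ := hΓ
  rcases le_or_gt (ENNReal.ofReal r) (ediam Γ) with hle | hlt
  · exact (hc x hx r hr hle).2.trans_lt ENNReal.ofReal_lt_top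
  rcases eq_or_ne (ediam Γ) 0 with hzero | hzero
  · rw [hausdorffOn_apply isClosed_closedBall.measurableSet]
    exact hausdorffMeasure_lt_top_of_subsingleton
      ((ediam_eq_zero_iff.1 hzero).anti inter_subset_right)
  · have hbound := (hc x hx _ (ENNReal.toReal_pos hzero hlt.ne_top) ENNReal.ofReal_toReal_le).2
    rw [hausdorffOn_apply isClosed_closedBall.measurableSet] at hbound ⊢
    have hsub : closedBall x r ∩ Γ ⊆ closedBall x (ediam Γ).toReal ∩ Γ := by
      refine fun y hy => ⟨?_, hy.2⟩
      rw [mem_closedBall, dist_edist]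
      exact ENNReal.toReal_mono hlt.ne_top (edist_le_ediam_of_mem hy.2 hx)
    exact (measure_mono hsub).trans_lt (hbound.trans_lt ENNReal.ofReal_lt_top)

lemma IsADRegularSet.isLocallyFiniteMeasure (hΓ : IsADRegularSet n Γ) :
    IsLocallyFiniteMeasure (hausdorffOn n Γ) := by
  refine ⟨fun x => ⟨closedBall x 1, closedBall_mem_nhds x one_pos, ?_⟩⟩
  rcases (closedBall x 1 ∩ Γ).eq_empty_or_nonempty with hempty | ⟨w, hwx, hw⟩
  · rw [hausdorffOn_apply isClosed_closedBall.measurableSet, hempty, measure_empty]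
    exact ENNReal.zero_lt_top
  · refine (measure_mono (closedBall_subset_closedBall' ?_)).trans_lt
      (hΓ.hausdorffOn_closedBall_lt_top hw two_pos)
    linarith [mem_closedBall'.1 hwx]

lemma IsADRegularSet.isLowerRegularOn (hΓ : IsADRegularSet n Γ) :
    IsLowerRegularOn n (hausdorffOn n Γ) Γ := by
  obtain ⟨c, hc, hreg⟩ := hΓ
  exact ⟨c⁻¹, inv_pos.2 hc, fun x hx r hr hdiam => (hreg x hx r hr hdiam).1⟩

lemma hausdorffOn_compl (hΓ : MeasurableSet Γ) : hausdorffOn n Γ Γᶜ = 0 := by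
  rw [hausdorffOn_apply hΓ.compl, compl_inter_self, measure_empty]

end Regular

end

end CZ

theorem theorem3p1_general {d n : ℕ} (hn : n = 0 ∨ 2 ≤ d) {U : Set (CZ.Rd d)} (hU : IsOpen U)
    (hne : U.Nonempty) {σ μ : Measure (CZ.Rd d)} [IsLocallyFiniteMeasure σ]
    (hσ : CZ.IsLowerRegularOn n σ (frontier U)) (hσU : σ (frontier U)ᶜ = 0)
    (hμ : CZ.HasGrowth n μ) (hμU : μ (closure U)ᶜ = 0) {k : CZ.Rd d → CZ.Rd d → ℂ}
    (hk : CZ.IsCZKernel n k) (hT : CZ.BoundedL2 k σ μ) : CZ.BoundedWeakL1 k Uᶜ μ := by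
  refine CZ.BoundedWeakL1Pos.boundedWeakL1 ?_ hk hU.measurableSet.compl
  rcases eq_or_ne n 0 with rfl | hn0
  · exact hk.boundedWeakL1Pos_of_dim_zero hμ Uᶜ
  · exact hT.boundedWeakL1Pos_compl hn0 (hn.resolve_left hn0) hk hμ hU hne hμU hσ hσU

theorem theorem3p1 (d : ℕ) (hd : 1 ≤ d) (U : Set (CZ.Rd d)) (hUo : IsOpen U)
    (hUc : IsConnected U) (hΓ : CZ.IsADRegularSet (d - 1) (frontier U))
    (μ : MeasureTheory.Measure (CZ.Rd d)) (hμ : CZ.HasGrowth (d - 1) μ)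
    (hμU : μ (closure U)ᶜ = 0)
    (k : CZ.Rd d → CZ.Rd d → ℂ) (hk : CZ.IsCZKernel (d - 1) k)
    (hT : CZ.BoundedL2 k (CZ.hausdorffOn (d - 1) (frontier U)) μ) :
    CZ.BoundedWeakL1 k Uᶜ μ := by
  have := hΓ.isLocallyFiniteMeasure
  exact theorem3p1_general (by omega) hUo hUc.nonempty hΓ.isLowerRegularOn
    (CZ.hausdorffOn_compl isClosed_frontier.measurableSet) hμ hμU hk hT
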